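/- Let $\mathrm{cl}$ be a closure operator on a finite set $X$. It is called standard if $\mathrm{cl}(\{a\})\setminus\{a\}$ is closed for every $a\in X$; put $\mathrm{cl}^b(A)=\bigcup_{a\in A}\mathrm{cl}(\{a\})$. A set $A\subseteq X$ is a minimal generator of $c\in X$ if $c\in\mathrm{cl}(A)$ and $c\notin\mathrm{cl}(A')$ for every $A'\subsetneq A$; it is a $D$-generator of $c$ if moreover $c\notin\mathrm{cl}^b(A)$ and every minimal generator $A'$ of $c$ with $A'\subseteq\mathrm{cl}^b(A)$ equals $A$. The $D$-base of $\mathrm{cl}$ is the set of implications $$\{\{a\}\to c : a,c\in X,\ c\in\mathrm{cl}(\{a\})\setminus\{a\}\}\cup\{A\to c : c\in X,\ A \text{ is a } D\text{-generator of } c\}.$$ An implicational base over $X$ is a collection $\Sigma$ of implications $A\to c$ with $A\cup\{c\}\subseteq X$; it induces the closure operator whose closed sets are the sets $F\subseteq X$ such that, for every $A\to c$ in $\Sigma$, $A\subseteq F$ implies $c\in F$. Its size is $|X|+\sum_{A\to c\in\Sigma}(|A|+1)$. **Theorem 5.** There is a polynomial-delay algorithm that computes the $D$-base of a standard closure system given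 by an arbitrary implicational base. That is, there are an algorithm (a random access machine program with logarithmic cost) and a polynomial $p$ such that, for every implicational base $(X,\Sigma)$ of size $s$ that induces a standard closure operator, the algorithm on input $(X,\Sigma)$ outputs every implication of the $D$-base exactly once and outputs nothing else, and then halts, where the time before the first output, between any two consecutive outputs, and after the last output is at most $p(s)$ each. -/

import Mathlib

/-! ## Closure operators, minimal generators, `D`-generators and the `D`-base -/

section Closure

variable {X : Type*}

/-- A closure operator `cl` is standard if `cl(a) \ {a}` is closed for every element `a`. -/
def IsStandard (cl : ClosureOperator (Set X)) : Prop :=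
  ∀ a : X, cl.IsClosed (cl {a} \ {a})

/-- `A` is a minimal generator of `c`: `c ∈ cl A`, but `c ∉ cl A'` for every `A' ⊂ A`. -/
def IsMinGen (cl : ClosureOperator (Set X)) (A : Set X) (c : X) : Prop :=
  c ∈ cl A ∧ ∀ A' : Set X, A' ⊂ A → c ∉ cl A'

/-- The binary part `cl^b` of a closure operator: `cl^b A = ⋃ a ∈ A, cl(a)`. -/
def binClosure (cl : ClosureOperator (Set X)) (A : Set X) : Set X :=
  ⋃ a ∈ A, cl {a}

/-- `A` is a `D`-generator of `c`: it is a minimal generator of `c` with `c ∉ cl^b A`, and it is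
the only minimal generator of `c` included in `cl^b A`. -/
def IsDGen (cl : ClosureOperator (Set X)) (A : Set X) (c : X) : Prop :=
  IsMinGen cl A c ∧ c ∉ binClosure cl A ∧
    ∀ A' : Set X, IsMinGen cl A' c → A' ⊆ binClosure cl A → A' = A

/-- An implication `prem → concl` over `X`. -/
structure Implication (X : Type*) where
  prem : Finset X
  concl : X

/-- The `D`-base of a closure operator: the valid binary implications `a → c` with
`c ∈ cl(a) \ {a}`, and the implications `A → c` where `A` is a `D`-generator of `c`. -/
def dBase (cl : ClosureOperator (Set X)) : Set (Implication X) :=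
  {I | ∃ a : X, I.prem = {a} ∧ I.concl ∈ cl {a} \ {a}} ∪ {I | IsDGen cl (I.prem : Set X) I.concl}

/-- A set is closed for a list of implications if it contains the conclusion of each implication
of which it contains the premise. -/
def IsModel (imps : List (Implication X)) (F : Set X) : Prop :=
  ∀ I ∈ imps, (I.prem : Set X) ⊆ F → I.concl ∈ F

/-- The closure operator induced by a list of implications: its closed sets are the models. -/
def impClosure (imps : List (Implication X)) : ClosureOperator (Set X) :=
  ClosureOperator.ofCompletePred (IsModel imps) (by
    intro S hS I hI hsub
    rw [Set.sInf_eq_sInter, Set.mem_sInter]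
    intro F hF
    refine hS F hF I hI (hsub.trans ?_)
    rw [Set.sInf_eq_sInter]
    exact Set.sInter_subset_of_mem hF)

end Closure

/-! ## Encodings and sizes

The ground set of an implicational base is numbered, i.e., it is `Fin n`. An implicational base
consists of `n` and of a list of implications (in any order, possibly with repetitions). -/

/-- The encoding of an implication `{a₁ < ... < aₖ} → c` as the word `c, k, a₁, ..., aₖ`. -/
def encodeImplication {n : ℕ} (I : Implication (Fin n)) : List ℕ :=
  (I.concl : ℕ) :: I.prem.card :: I.prem.sort.map Fin.val

/-- The encoding of an implicational base as the word that consists of the size of the ground set,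
the number of implications, and the encodings of the implications one after the other. -/
def encodeIB (n : ℕ) (imps : List (Implication (Fin n))) : List ℕ :=
  n :: imps.length :: imps.flatMap encodeImplication

/-- The size of an implicational base: the size of the ground set plus the total size of the
implications, where `A → c` counts for `|A| + 1`. -/
def sizeIB (n : ℕ) (imps : List (Implication (Fin n))) : ℕ :=
  n + (imps.map (fun I => I.prem.card + 1)).sum

/-! ## Random access machines with logarithmic cost and output instructions

Programs are structured (sequence, conditional, loop). A machine has registers and finitely many
(those named in the program) random access memory banks; all of them hold natural numbers.
Every elementary operation is charged the bit length of the numbers involved, including the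
addresses. Memory is unbounded. -/

namespace RAM

/-- Arithmetic expressions: constants, registers, indirect access to a memory bank, addition,
truncated subtraction, multiplication. -/
inductive Expr : Type
  | const (k : ℕ)
  | reg (x : ℕ)
  | read (bank : ℕ) (addr : Expr)
  | add (e₁ e₂ : Expr)
  | sub (e₁ e₂ : Expr)
  | mul (e₁ e₂ : Expr)

/-- Programs. `put e` appends the value of `e` to the output word under construction;
`emit` completes this word, which is thereby output, and begins an empty one. -/
inductive Prog : Type
  | skip
  | assign (x : ℕ) (e : Expr)
  | write (bank : ℕ) (addr : Expr) (e : Expr)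
  | put (e : Expr)
  | emit
  | seq (P Q : Prog)
  | ite (e : Expr) (P Q : Prog)
  | while (e : Expr) (P : Prog)

/-- Configurations: the registers, the memory banks, the time elapsed, the output word under
construction, and the list of the words output so far, each with the time of its output,
in the order of output. -/
structure Config where
  reg : ℕ → ℕ
  mem : ℕ → ℕ → ℕ
  time : ℕ
  word : List ℕ
  outs : List (List ℕ × ℕ)

/-- The value of an expression. -/
def Expr.val (σ : Config) : Expr → ℕ
  | .const k => k
  | .reg x => σ.reg x
  | .read b e => σ.mem b (e.val σ)
  | .add e₁ e₂ => e₁.val σ + e₂.val σ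
  | .sub e₁ e₂ => e₁.val σ - e₂.val σ
  | .mul e₁ e₂ => e₁.val σ * e₂.val σ

/-- The cost of the evaluation of an expression: every node is charged one plus the bit length
of its value. -/
def Expr.cost (σ : Config) : Expr → ℕ
  | .const k => 1 + k.size
  | .reg x => 1 + (σ.reg x).size
  | .read b e => 1 + (σ.mem b (e.val σ)).size + e.cost σ
  | .add e₁ e₂ => 1 + (e₁.val σ + e₂.val σ).size + e₁.cost σ + e₂.cost σ
  | .sub e₁ e₂ => 1 + (e₁.val σ - e₂.val σ).size + e₁.cost σ + e₂.cost σ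
  | .mul e₁ e₂ => 1 + (e₁.val σ * e₂.val σ).size + e₁.cost σ + e₂.cost σ

/-- Let time pass. -/
def Config.tick (σ : Config) (t : ℕ) : Config :=
  { σ with time := σ.time + t }

/-- `Exec P σ τ`: the program `P`, started in the configuration `σ`, halts in the
configuration `τ`. -/
inductive Exec : Prog → Config → Config → Prop
  | skip (σ : Config) : Exec .skip σ (σ.tick 1)
  | assign (x : ℕ) (e : Expr) (σ : Config) :
      Exec (.assign x e) σ
        { σ.tick (1 + e.cost σ) with reg := Function.update σ.reg x (e.val σ) }
  | write (b : ℕ) (a e : Expr) (σ : Config) :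
      Exec (.write b a e) σ
        { σ.tick (1 + a.cost σ + e.cost σ) with
          mem := Function.update σ.mem b (Function.update (σ.mem b) (a.val σ) (e.val σ)) }
  | put (e : Expr) (σ : Config) :
      Exec (.put e) σ { σ.tick (1 + e.cost σ) with word := σ.word ++ [e.val σ] }
  | emit (σ : Config) :
      Exec .emit σ
        { σ.tick 1 with word := [], outs := σ.outs ++ [(σ.word, σ.time + 1)] }
  | seq (P Q : Prog) (σ τ υ : Config) : Exec P σ τ → Exec Q τ υ → Exec (.seq P Q) σ υ
  | ite_true (e : Expr) (P Q : Prog) (σ τ : Config) : e.val σ ≠ 0 →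
      Exec P (σ.tick (1 + e.cost σ)) τ → Exec (.ite e P Q) σ τ
  | ite_false (e : Expr) (P Q : Prog) (σ τ : Config) : e.val σ = 0 →
      Exec Q (σ.tick (1 + e.cost σ)) τ → Exec (.ite e P Q) σ τ
  | while_true (e : Expr) (P : Prog) (σ τ υ : Config) : e.val σ ≠ 0 →
      Exec P (σ.tick (1 + e.cost σ)) τ → Exec (.while e P) τ υ → Exec (.while e P) σ υ
  | while_false (e : Expr) (P : Prog) (σ : Config) : e.val σ = 0 →
      Exec (.while e P) σ (σ.tick (1 + e.cost σ))

/-- The initial configuration: the input word is in the first cells of memory bank `0`, all other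
cells and all registers hold `0`, and nothing has been output. -/
def start (input : List ℕ) : Config where
  reg := fun _ => 0
  mem := fun b i => if b = 0 then input.getD i 0 else 0
  time := 0
  word := []
  outs := []

/-- On the given input, `P` halts after having output the words of `S`, each of them exactly once
(and nothing else), and the delay is at most `d`: at most `d` units of time pass before the first
output, between two consecutive outputs, and after the last output until `P` halts. -/
def EnumeratesWithDelay (P : Prog) (input : List ℕ) (S : Set (List ℕ)) (d : ℕ) : Prop :=
  ∃ τ : Config, Exec P (start input) τ ∧
    τ.word = [] ∧
    (τ.outs.map Prod.fst).Nodup ∧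
    {w | w ∈ τ.outs.map Prod.fst} = S ∧
    List.IsChain (fun s t => t ≤ s + d) (0 :: τ.outs.map Prod.snd ++ [τ.time])

end RAM

namespace RAM

/-! ### Syntactic bounds on the running time -/

/-- A bound on the bit length of the value of an expression if all registers and cells have at
most `N` bits. -/
def Expr.bits (N : ℕ) : Expr → ℕ
  | .const k => k
  | .reg _ => N
  | .read _ _ => N
  | .add e₁ e₂ => e₁.bits N + e₂.bits N + 1
  | .sub e₁ _ => e₁.bits N
  | .mul e₁ e₂ => e₁.bits N + e₂.bits N

/-- A bound on the cost of an expression if all registers and cells have at most `N` bits. -/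
def Expr.bound (N : ℕ) : Expr → ℕ
  | .const k => 1 + k
  | .reg _ => 1 + N
  | .read _ e => 1 + N + e.bound N
  | .add e₁ e₂ => 1 + (e₁.bits N + e₂.bits N + 1) + e₁.bound N + e₂.bound N
  | .sub e₁ e₂ => 1 + e₁.bits N + e₁.bound N + e₂.bound N
  | .mul e₁ e₂ => 1 + (e₁.bits N + e₂.bits N) + e₁.bound N + e₂.bound N

/-- A bound on the running time of a program if all registers and cells have at most `N` bits
and every loop is iterated at most `N` times. -/
def Prog.bound (N : ℕ) : Prog → ℕ
  | .skip => 1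
  | .assign _ e => 1 + e.bound N
  | .write _ a e => 1 + a.bound N + e.bound N
  | .put e => 1 + e.bound N
  | .emit => 1
  | .seq P Q => P.bound N + Q.bound N
  | .ite e P Q => 1 + e.bound N + P.bound N + Q.bound N
  | .while e P => N * (1 + e.bound N + P.bound N) + (1 + e.bound N)

open Polynomial in
theorem Expr.exists_polynomial_bits (e : Expr) : ∃ p : ℕ[X], ∀ N, p.eval N = e.bits N := by
  induction e with
  | const k => exact ⟨C k, fun N => by simp [bits]⟩
  | reg x => exact ⟨X, fun N => by simp [bits]⟩
  | read b e ih => exact ⟨X, fun N => by simp [bits]⟩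
  | add e₁ e₂ h₁ h₂ =>
    obtain ⟨p, hp⟩ := h₁; obtain ⟨q, hq⟩ := h₂
    exact ⟨p + q + 1, fun N => by simp [bits, hp, hq]⟩
  | sub e₁ e₂ h₁ h₂ => exact h₁
  | mul e₁ e₂ h₁ h₂ =>
    obtain ⟨p, hp⟩ := h₁; obtain ⟨q, hq⟩ := h₂
    exact ⟨p + q, fun N => by simp [bits, hp, hq]⟩

open Polynomial in
theorem Expr.exists_polynomial_bound (e : Expr) : ∃ p : ℕ[X], ∀ N, p.eval N = e.bound N := by
  induction e with
  | const k => exact ⟨1 + C k, fun N => by simp [bound]⟩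
  | reg x => exact ⟨1 + X, fun N => by simp [bound]⟩
  | read b e ih =>
    obtain ⟨p, hp⟩ := ih
    exact ⟨1 + X + p, fun N => by simp [bound, hp]⟩
  | add e₁ e₂ h₁ h₂ =>
    obtain ⟨p, hp⟩ := h₁; obtain ⟨q, hq⟩ := h₂
    obtain ⟨p', hp'⟩ := e₁.exists_polynomial_bits; obtain ⟨q', hq'⟩ := e₂.exists_polynomial_bits
    exact ⟨1 + (p' + q' + 1) + p + q, fun N => by simp [bound, hp, hq, hp', hq']⟩
  | sub e₁ e₂ h₁ h₂ =>
    obtain ⟨p, hp⟩ := h₁; obtain ⟨q, hq⟩ := h₂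
    obtain ⟨p', hp'⟩ := e₁.exists_polynomial_bits
    exact ⟨1 + p' + p + q, fun N => by simp [bound, hp, hq, hp']⟩
  | mul e₁ e₂ h₁ h₂ =>
    obtain ⟨p, hp⟩ := h₁; obtain ⟨q, hq⟩ := h₂
    obtain ⟨p', hp'⟩ := e₁.exists_polynomial_bits; obtain ⟨q', hq'⟩ := e₂.exists_polynomial_bits
    exact ⟨1 + (p' + q') + p + q, fun N => by simp [bound, hp, hq, hp', hq']⟩

open Polynomial in
theorem Prog.exists_polynomial_bound : ∀ P : Prog, ∃ p : ℕ[X], ∀ N, p.eval N = P.bound N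
  | .skip => ⟨1, fun N => by simp [bound]⟩
  | .assign _ e =>
    let ⟨p, hp⟩ := e.exists_polynomial_bound
    ⟨1 + p, fun N => by simp [bound, hp]⟩
  | .write _ a e =>
    let ⟨p, hp⟩ := a.exists_polynomial_bound
    let ⟨q, hq⟩ := e.exists_polynomial_bound
    ⟨1 + p + q, fun N => by simp [bound, hp, hq]⟩
  | .put e =>
    let ⟨p, hp⟩ := e.exists_polynomial_bound
    ⟨1 + p, fun N => by simp [bound, hp]⟩
  | .emit => ⟨1, fun N => by simp [bound]⟩
  | .seq P Q =>
    let ⟨p, hp⟩ := P.exists_polynomial_bound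
    let ⟨q, hq⟩ := Q.exists_polynomial_bound
    ⟨p + q, fun N => by simp [bound, hp, hq]⟩
  | .ite e P Q =>
    let ⟨p, hp⟩ := P.exists_polynomial_bound
    let ⟨q, hq⟩ := Q.exists_polynomial_bound
    let ⟨r, hr⟩ := e.exists_polynomial_bound
    ⟨1 + r + p + q, fun N => by simp [bound, hp, hq, hr]⟩
  | .while e P =>
    let ⟨p, hp⟩ := P.exists_polynomial_bound
    let ⟨r, hr⟩ := e.exists_polynomial_bound
    ⟨X * (1 + r + p) + (1 + r), fun N => by simp [bound, hp, hr]⟩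

/-! ### States -/

/-- A configuration without the clock. -/
@[ext] structure State where
  reg : ℕ → ℕ
  mem : ℕ → ℕ → ℕ
  word : List ℕ
  done : List (List ℕ)

/-- The configuration without the clock. -/
def Config.st (σ : Config) : State := ⟨σ.reg, σ.mem, σ.word, σ.outs.map Prod.fst⟩

/-- The value of an expression in a state. -/
def Expr.eval (s : State) (e : Expr) : ℕ := e.val ⟨s.reg, s.mem, 0, [], []⟩

section eval
variable (s : State)

@[simp] theorem Expr.eval_const (k : ℕ) : (Expr.const k).eval s = k := rfl
@[simp] theorem Expr.eval_reg (x : ℕ) : (Expr.reg x).eval s = s.reg x := rfl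
@[simp] theorem Expr.eval_read (b : ℕ) (e : Expr) :
    (Expr.read b e).eval s = s.mem b (e.eval s) := rfl
@[simp] theorem Expr.eval_add (e₁ e₂ : Expr) :
    (Expr.add e₁ e₂).eval s = e₁.eval s + e₂.eval s := rfl
@[simp] theorem Expr.eval_sub (e₁ e₂ : Expr) :
    (Expr.sub e₁ e₂).eval s = e₁.eval s - e₂.eval s := rfl
@[simp] theorem Expr.eval_mul (e₁ e₂ : Expr) :
    (Expr.mul e₁ e₂).eval s = e₁.eval s * e₂.eval s := rfl

end eval

theorem Expr.val_eq_eval (e : Expr) (σ : Config) : e.val σ = e.eval σ.st := by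
  induction e with
  | const k => rfl
  | reg x => rfl
  | read b e ih => simp [val, ih, Config.st]
  | add e₁ e₂ h₁ h₂ => simp [val, h₁, h₂]
  | sub e₁ e₂ h₁ h₂ => simp [val, h₁, h₂]
  | mul e₁ e₂ h₁ h₂ => simp [val, h₁, h₂]

/-- All registers and cells have at most `N` bits. -/
def Ok (N : ℕ) (s : State) : Prop := (∀ x, s.reg x < 2 ^ N) ∧ ∀ b a, s.mem b a < 2 ^ N

theorem Expr.eval_lt {N : ℕ} {s : State} (hs : Ok N s) (e : Expr) : e.eval s < 2 ^ e.bits N := by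
  induction e with
  | const k => exact Nat.lt_two_pow_self
  | reg x => exact hs.1 x
  | read b e ih => exact hs.2 _ _
  | add e₁ e₂ h₁ h₂ =>
    simp only [eval_add, bits]
    have h₃ : 2 ^ e₁.bits N ≤ 2 ^ (e₁.bits N + e₂.bits N) :=
      Nat.pow_le_pow_right (by norm_num) (by omega)
    have h₄ : 2 ^ e₂.bits N ≤ 2 ^ (e₁.bits N + e₂.bits N) :=
      Nat.pow_le_pow_right (by norm_num) (by omega)
    rw [pow_succ]; omega
  | sub e₁ e₂ h₁ h₂ => exact (Nat.sub_le _ _).trans_lt h₁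
  | mul e₁ e₂ h₁ h₂ =>
    simp only [eval_mul, bits, pow_add]
    exact Nat.mul_lt_mul'' h₁ h₂

theorem Expr.cost_le {N : ℕ} {σ : Config} (hs : Ok N σ.st) (e : Expr) :
    e.cost σ ≤ e.bound N := by
  have key : ∀ e : Expr, (e.val σ).size ≤ e.bits N := fun e => by
    rw [Nat.size_le, e.val_eq_eval]; exact e.eval_lt hs
  induction e with
  | const k => have := key (.const k); simp only [val, bits] at this; simp only [cost, bound]; omega
  | reg x => have := key (.reg x); simp only [val, bits] at this; simp only [cost, bound]; omega
  | read b e ih =>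
    have := key (.read b e); simp only [val, bits] at this; simp only [cost, bound]; omega
  | add e₁ e₂ h₁ h₂ =>
    have := key (.add e₁ e₂); simp only [val, bits] at this; simp only [cost, bound]; omega
  | sub e₁ e₂ h₁ h₂ =>
    have := key (.sub e₁ e₂); simp only [val, bits] at this; simp only [cost, bound]; omega
  | mul e₁ e₂ h₁ h₂ =>
    have := key (.mul e₁ e₂); simp only [val, bits] at this; simp only [cost, bound]; omega

/-! ### Timed executions -/

/-- The outputs of `τ` are those of `σ` and further ones, made in the time between. -/
def Extends (σ τ : Config) : Prop :=
  σ.time ≤ τ.time ∧ ∃ new : List (List ℕ × ℕ),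
    τ.outs = σ.outs ++ new ∧ ∀ o ∈ new, σ.time ≤ o.2 ∧ o.2 ≤ τ.time

theorem Extends.trans {σ τ υ : Config} (h₁ : Extends σ τ) (h₂ : Extends τ υ) : Extends σ υ := by
  obtain ⟨l₁, n₁, e₁, b₁⟩ := h₁
  obtain ⟨l₂, n₂, e₂, b₂⟩ := h₂
  refine ⟨l₁.trans l₂, n₁ ++ n₂, by rw [e₂, e₁, List.append_assoc], fun o ho => ?_⟩
  rcases List.mem_append.1 ho with ho | ho
  · have := b₁ o ho; omega
  · have := b₂ o ho; omega

theorem Extends.of_outs_eq {σ τ : Config} (h : σ.time ≤ τ.time) (h' : τ.outs = σ.outs) :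
    Extends σ τ := ⟨h, [], by simp [h'], by simp⟩

/-- From every configuration with state `s`, the program `P` runs for at most `k` units of time
and halts in state `s'`. -/
def Takes (P : Prog) (s : State) (k : ℕ) (s' : State) : Prop :=
  ∀ σ : Config, σ.st = s → ∃ τ, Exec P σ τ ∧ τ.st = s' ∧ τ.time ≤ σ.time + k ∧ Extends σ τ

/-- Started in state `s`, the program `P` halts within time `P.bound N` in a state that
satisfies `Q`, and all numbers that occur have at most `N` bits if this is the case initially. -/
def Runs (N : ℕ) (P : Prog) (s : State) (Q : State → Prop) : Prop :=
  Ok N s → ∃ s', Takes P s (P.bound N) s' ∧ Ok N s' ∧ Q s'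

variable {N : ℕ} {P P' : Prog} {s : State} {Q Q' : State → Prop}

theorem Runs.intro (h : Ok N s → Runs N P s Q) : Runs N P s Q := fun hs => h hs hs

theorem Runs.mono (h : Runs N P s Q) (hQ : ∀ s', Q s' → Q' s') : Runs N P s Q' := fun hs =>
  let ⟨s', h₁, h₂, h₃⟩ := h hs
  ⟨s', h₁, h₂, hQ s' h₃⟩

theorem Runs.skip (h : Q s) : Runs N .skip s Q := fun hs => by
  refine ⟨s, fun σ hσ => ⟨_, .skip σ, hσ, ?_, ?_⟩, hs, h⟩
  · simp [Config.tick, Prog.bound]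
  · exact .of_outs_eq (by simp [Config.tick]) rfl

/-- The state after an assignment. -/
def State.set (s : State) (x v : ℕ) : State := { s with reg := Function.update s.reg x v }

/-- The state after a write. -/
def State.store (s : State) (b a v : ℕ) : State :=
  { s with mem := Function.update s.mem b (Function.update (s.mem b) a v) }

@[simp] theorem State.set_mem (x v : ℕ) : (s.set x v).mem = s.mem := rfl
@[simp] theorem State.set_word (x v : ℕ) : (s.set x v).word = s.word := rfl
@[simp] theorem State.set_done (x v : ℕ) : (s.set x v).done = s.done := rfl
@[simp] theorem State.set_reg_self (x v : ℕ) : (s.set x v).reg x = v := by simp [State.set]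
@[simp] theorem State.store_reg (b a v : ℕ) : (s.store b a v).reg = s.reg := rfl

theorem State.set_reg (x v y : ℕ) : (s.set x v).reg y = if y = x then v else s.reg y := by
  simp [State.set, Function.update_apply]

theorem State.set_reg_of_ne {x v y : ℕ} (h : y ≠ x) : (s.set x v).reg y = s.reg y := by
  simp [State.set, h]

theorem State.store_mem (b a v b' : ℕ) :
    (s.store b a v).mem b' = if b' = b then Function.update (s.mem b) a v else s.mem b' := by
  simp [State.store, Function.update_apply]

theorem State.store_mem_of_ne {b a v b' : ℕ} (h : b' ≠ b) : (s.store b a v).mem b' = s.mem b' := by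
  simp [State.store, h]

theorem Ok.set (hs : Ok N s) {x v : ℕ} (hv : v < 2 ^ N) : Ok N (s.set x v) := by
  refine ⟨fun y => ?_, hs.2⟩
  rw [State.set_reg]; split_ifs; exacts [hv, hs.1 y]

theorem Ok.store (hs : Ok N s) {b a v : ℕ} (hv : v < 2 ^ N) : Ok N (s.store b a v) := by
  refine ⟨hs.1, fun b' a' => ?_⟩
  rw [State.store_mem]; split_ifs
  · rw [Function.update_apply]; split_ifs; exacts [hv, hs.2 _ _]
  · exact hs.2 _ _

theorem Runs.assign {x : ℕ} {e : Expr} (hv : e.eval s < 2 ^ N) (h : Q (s.set x (e.eval s))) :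
    Runs N (.assign x e) s Q := fun hs => by
  refine ⟨_, fun σ hσ => ⟨_, .assign x e σ, ?_, ?_, ?_⟩, hs.set hv, h⟩
  · subst hσ; rw [← e.val_eq_eval]; rfl
  · have := e.cost_le (hσ ▸ hs)
    simp only [Config.tick, Prog.bound]; omega
  · exact .of_outs_eq (by simp [Config.tick]) rfl

theorem Runs.write {b : ℕ} {a e : Expr} (hv : e.eval s < 2 ^ N)
    (h : Q (s.store b (a.eval s) (e.eval s))) : Runs N (.write b a e) s Q := fun hs => by
  refine ⟨_, fun σ hσ => ⟨_, .write b a e σ, ?_, ?_, ?_⟩, hs.store hv, h⟩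
  · subst hσ; rw [← e.val_eq_eval, ← a.val_eq_eval]; rfl
  · have := e.cost_le (hσ ▸ hs)
    have := a.cost_le (hσ ▸ hs)
    simp only [Config.tick, Prog.bound]; omega
  · exact .of_outs_eq (by simp [Config.tick, add_assoc]) rfl

theorem Runs.put {e : Expr} (h : Q { s with word := s.word ++ [e.eval s] }) :
    Runs N (.put e) s Q := fun hs => by
  refine ⟨{ s with word := s.word ++ [e.eval s] }, fun σ hσ => ⟨_, .put e σ, ?_, ?_, ?_⟩, hs, h⟩
  · subst hσ; rw [← e.val_eq_eval]; rfl
  · have := e.cost_le (hσ ▸ hs)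
    simp only [Config.tick, Prog.bound]; omega
  · exact .of_outs_eq (by simp [Config.tick]) rfl

theorem Runs.emit (h : Q { s with word := [], done := s.done ++ [s.word] }) :
    Runs N .emit s Q := fun hs => by
  refine ⟨{ s with word := [], done := s.done ++ [s.word] },
    fun σ hσ => ⟨_, .emit σ, ?_, ?_, ?_⟩, hs, h⟩
  · subst hσ; simp [Config.st, Config.tick]
  · simp [Config.tick, Prog.bound]
  · exact ⟨by simp [Config.tick], [(σ.word, σ.time + 1)], rfl, by simp [Config.tick]⟩

theorem Takes.seq {s₁ s₂ s₃ : State} {k l : ℕ} (h : Takes P s₁ k s₂) (h' : Takes P' s₂ l s₃) :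
    Takes (.seq P P') s₁ (k + l) s₃ := fun σ hσ => by
  obtain ⟨τ, e, hτ, t, x⟩ := h σ hσ
  obtain ⟨υ, e', hυ, t', x'⟩ := h' τ hτ
  exact ⟨υ, .seq _ _ _ _ _ e e', hυ, by omega, x.trans x'⟩

theorem Runs.seq (h : Runs N P s fun s' => Runs N P' s' Q) : Runs N (.seq P P') s Q := fun hs => by
  obtain ⟨s₁, t₁, o₁, h₁⟩ := h hs
  obtain ⟨s₂, t₂, o₂, h₂⟩ := h₁ o₁
  exact ⟨s₂, t₁.seq t₂, o₂, h₂⟩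

theorem Extends.tick {σ : Config} (k : ℕ) : Extends σ (σ.tick k) :=
  .of_outs_eq (by simp [Config.tick]) rfl

theorem Runs.ite {e : Expr} (h : e.eval s ≠ 0 → Runs N P s Q) (h' : e.eval s = 0 → Runs N P' s Q) :
    Runs N (.ite e P P') s Q := fun hs => by
  by_cases he : e.eval s = 0
  · obtain ⟨s', t, o, q⟩ := h' he hs
    refine ⟨s', fun σ hσ => ?_, o, q⟩
    obtain ⟨τ, x, hτ, ht, ext⟩ := t (σ.tick (1 + e.cost σ)) hσ
    have := e.cost_le (hσ ▸ hs)
    refine ⟨τ, .ite_false _ _ _ _ _ (by rw [e.val_eq_eval, hσ, he]) x, hτ, ?_,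
      (Extends.tick _).trans ext⟩
    simp only [Config.tick, Prog.bound] at ht ⊢; omega
  · obtain ⟨s', t, o, q⟩ := h he hs
    refine ⟨s', fun σ hσ => ?_, o, q⟩
    obtain ⟨τ, x, hτ, ht, ext⟩ := t (σ.tick (1 + e.cost σ)) hσ
    have := e.cost_le (hσ ▸ hs)
    refine ⟨τ, .ite_true _ _ _ _ _ (by rwa [e.val_eq_eval, hσ]) x, hτ, ?_,
      (Extends.tick _).trans ext⟩
    simp only [Config.tick, Prog.bound] at ht ⊢; omega

theorem Takes.while_true {e : Expr} (hs : Ok N s) {s₁ s₂ : State} {k l : ℕ} (he : e.eval s ≠ 0)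
    (h : Takes P s k s₁) (h' : Takes (.while e P) s₁ l s₂) :
    Takes (.while e P) s (1 + e.bound N + k + l) s₂ := fun σ hσ => by
  obtain ⟨τ, x, hτ, t, y⟩ := h (σ.tick (1 + e.cost σ)) hσ
  obtain ⟨υ, x', hυ, t', y'⟩ := h' τ hτ
  have := e.cost_le (hσ ▸ hs)
  refine ⟨υ, .while_true _ _ _ _ _ (by rwa [e.val_eq_eval, hσ]) x x', hυ, ?_,
    ((Extends.tick _).trans y).trans y'⟩
  simp only [Config.tick] at t; omega

theorem Takes.while_false {e : Expr} (hs : Ok N s) (he : e.eval s = 0) :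
    Takes (.while e P) s (1 + e.bound N) s := fun σ hσ => by
  have := e.cost_le (hσ ▸ hs)
  refine ⟨_, .while_false _ _ _ (by rw [e.val_eq_eval, hσ, he]), hσ, ?_, .tick _⟩
  simp only [Config.tick]; omega

/-! ### Frames and bounded loops -/

/-- The registers below `r` and the memory banks below `b` agree. -/
def Frame (r b : ℕ) (s s' : State) : Prop :=
  (∀ x < r, s'.reg x = s.reg x) ∧ ∀ y < b, s'.mem y = s.mem y

theorem Frame.rfl {r b : ℕ} : Frame r b s s := ⟨fun _ _ => Eq.refl _, fun _ _ => Eq.refl _⟩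

theorem Frame.trans {r b r' b' : ℕ} {s₁ s₂ s₃ : State} (h : Frame r b s₁ s₂) (h' : Frame r' b' s₂ s₃)
    (hr : r ≤ r' := by omega) (hb : b ≤ b' := by omega) : Frame r b s₁ s₃ :=
  ⟨fun x hx => (h'.1 x (by omega)).trans (h.1 x hx),
    fun y hy => (h'.2 y (by omega)).trans (h.2 y hy)⟩

theorem Frame.mono {r b r' b' : ℕ} {s s' : State} (h : Frame r b s s')
    (hr : r' ≤ r := by omega) (hb : b' ≤ b := by omega) : Frame r' b' s s' :=
  ⟨fun x hx => h.1 x (by omega), fun y hy => h.2 y (by omega)⟩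

theorem Frame.set {r b x v : ℕ} (h : r ≤ x := by omega) : Frame r b s (s.set x v) :=
  ⟨fun _ hy => State.set_reg_of_ne (by omega), fun _ _ => Eq.refl _⟩

theorem Frame.store {r b b' a v : ℕ} (h : b ≤ b' := by omega) : Frame r b s (s.store b' a v) :=
  ⟨fun _ _ => Eq.refl _, fun _ hy => State.store_mem_of_ne (by omega)⟩

theorem Frame.then_set {r b x v : ℕ} {s s' : State} (h : Frame r b s s') (hr : r ≤ x := by omega) :
    Frame r b s (s'.set x v) := h.trans (Frame.set (b := b) hr)

theorem Frame.then_store {r b b' a v : ℕ} {s s' : State} (h : Frame r b s s')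
    (hb : b ≤ b' := by omega) : Frame r b s (s'.store b' a v) :=
  h.trans (Frame.store (r := r) hb)

/-- The outputs agree. -/
def SameOut (s s' : State) : Prop := s'.word = s.word ∧ s'.done = s.done

theorem SameOut.rfl : SameOut s s := ⟨Eq.refl _, Eq.refl _⟩

theorem SameOut.trans {s₁ s₂ s₃ : State} (h : SameOut s₁ s₂) (h' : SameOut s₂ s₃) :
    SameOut s₁ s₃ := ⟨h'.1.trans h.1, h'.2.trans h.2⟩

/-- `for i = 0, ..., (reg x) - 1 do P`. -/
def Prog.loop (i x : ℕ) (P : Prog) : Prog :=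
  .seq (.assign i (.const 0))
    (.while (.sub (.reg x) (.reg i)) (.seq P (.assign i (.add (.reg i) (.const 1)))))

/-- The rule for bounded loops. -/
theorem Runs.loop {i x : ℕ} (K b : ℕ) (Inv : ℕ → State → Prop) (hx : s.reg x = K)
    (hxi : x < i) (hK : K ≤ N) (h0 : Inv 0 (s.set i 0))
    (step : ∀ j < K, ∀ s', Frame i b s s' → s'.reg i = j → Inv j s' →
      Runs N P s' fun s'' => Frame (i + 1) b s' s'' ∧ Inv (j + 1) (s''.set i (j + 1)))
    (hQ : ∀ s', Frame i b s s' → s'.reg i = K → Inv K s' → Q s') :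
    Runs N (.loop i x P) s Q := by
  refine Runs.seq (Runs.assign (by simp) ?_)
  have main : ∀ l j s', j + l = K → Ok N s' → Frame i b s s' → s'.reg i = j → Inv j s' →
      ∃ s'', Takes (.while (.sub (.reg x) (.reg i)) (.seq P (.assign i (.add (.reg i) (.const 1)))))
        s' (l * (1 + (Expr.sub (.reg x) (.reg i)).bound N +
          (Prog.seq P (.assign i (.add (.reg i) (.const 1)))).bound N) +
          (1 + (Expr.sub (.reg x) (.reg i)).bound N)) s'' ∧ Ok N s'' ∧ Q s'' := by
    intro l
    induction l with
    | zero =>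
      intro j s' hj ok fr hi inv
      have hx' : s'.reg x = K := (fr.1 x hxi).trans hx
      refine ⟨s', ?_, ok, hQ s' fr (by omega) (by rwa [← hj])⟩
      rw [Nat.zero_mul, Nat.zero_add]
      exact Takes.while_false ok (by simp [hx', hi]; omega)
    | succ l ih =>
      intro j s' hj ok fr hi inv
      have hx' : s'.reg x = K := (fr.1 x hxi).trans hx
      have hb : j + 1 < 2 ^ N := lt_of_le_of_lt (by omega : j + 1 ≤ N) Nat.lt_two_pow_self
      have hr : Runs N (Prog.seq P (.assign i (.add (.reg i) (.const 1)))) s' fun s'' =>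
          Frame i b s' s'' ∧ s''.reg i = j + 1 ∧ Inv (j + 1) s'' := by
        refine Runs.seq ((step j (by omega) s' fr hi inv).mono fun s'' h => ?_)
        have hi'' : s''.reg i = j := (h.1.1 i (by omega)).trans hi
        refine Runs.assign (by simpa [hi''] using hb) ?_
        simp only [Expr.eval_add, Expr.eval_reg, Expr.eval_const, hi'']
        exact ⟨(h.1.mono (by omega) le_rfl).then_set, by simp, h.2⟩
      obtain ⟨s₁, t₁, o₁, f₁, i₁, inv₁⟩ := hr ok
      obtain ⟨s₂, t₂, o₂, q₂⟩ := ih (j + 1) s₁ (by omega) o₁ (fr.trans f₁) i₁ inv₁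
      refine ⟨s₂, ?_, o₂, q₂⟩
      have := Takes.while_true (e := .sub (.reg x) (.reg i)) ok (by simp [hx', hi]; omega) t₁ t₂
      rw [Nat.succ_mul]
      convert this using 1
      ring
  intro ok
  obtain ⟨s'', t, o, q⟩ := main K 0 (s.set i 0) (by omega) ok (Frame.set le_rfl) (by simp) h0
  refine ⟨s'', fun σ hσ => ?_, o, q⟩
  obtain ⟨τ, h1, h2, h3, h4⟩ := t σ hσ
  refine ⟨τ, h1, h2, h3.trans ?_, h4⟩
  simp only [Prog.bound]
  gcongr

/-- The rule for bounded loops that do not touch the output. -/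
theorem Runs.loop' {i x : ℕ} (K b : ℕ) (Inv : ℕ → State → Prop) (hx : s.reg x = K)
    (hxi : x < i) (hK : K ≤ N) (h0 : Inv 0 (s.set i 0))
    (step : ∀ j < K, ∀ s', Frame i b s s' → s'.reg i = j → Inv j s' →
      Runs N P s' fun s'' => Frame (i + 1) b s' s'' ∧ SameOut s' s'' ∧
        Inv (j + 1) (s''.set i (j + 1)))
    (hQ : ∀ s', Frame i b s s' → SameOut s s' → Inv K s' → Q s') :
    Runs N (.loop i x P) s Q := by
  refine Runs.loop K b (fun j s' => SameOut s s' ∧ Inv j s') hx hxi hK ⟨⟨rfl, rfl⟩, h0⟩ ?_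
    fun s' f _ h => hQ s' f h.1 h.2
  intro j hj s' f hi h
  refine (step j hj s' f hi h.2).mono fun s'' h' => ⟨h'.1, ?_, h'.2.2⟩
  exact h.1.trans (h'.2.1.trans ⟨rfl, rfl⟩)

/-- `for i = 0, ..., (reg 0) - 1 do` write `e` to the cell `base + i` of bank `b`. -/
def Prog.fill (i b : ℕ) (base e : Expr) : Prog := .loop i 0 (.write b (.add base (.reg i)) e)

/-- The state after `Prog.fill`. -/
def State.fill (s : State) (i b B n : ℕ) (v : ℕ → ℕ) : State :=
  { s with
    reg := Function.update s.reg i n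
    mem := Function.update s.mem b
      (fun a => if B ≤ a ∧ a < B + n then v (a - B) else s.mem b a) }

theorem State.fill_frame {i b B n : ℕ} {v : ℕ → ℕ} {r c : ℕ} (hr : r ≤ i := by omega)
    (hc : c ≤ b := by omega) : Frame r c s (s.fill i b B n v) := by
  refine ⟨fun x hx => ?_, fun y hy => ?_⟩
  · have : x ≠ i := by omega
    simp [State.fill, this]
  · have : y ≠ b := by omega
    simp [State.fill, this]

theorem Frame.then_fill {s' : State} {i b B n : ℕ} {v : ℕ → ℕ} {r c : ℕ} (h : Frame r c s s')
    (hr : r ≤ i := by omega) (hc : c ≤ b := by omega) : Frame r c s (s'.fill i b B n v) :=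
  h.trans (State.fill_frame hr hc)

theorem State.fill_mem_self {i b B n : ℕ} {v : ℕ → ℕ} (a : ℕ) : (s.fill i b B n v).mem b a =
    if B ≤ a ∧ a < B + n then v (a - B) else s.mem b a := by simp [State.fill]

theorem State.fill_mem_of_ne {i b B n : ℕ} {v : ℕ → ℕ} {b' : ℕ} (h : b' ≠ b) :
    (s.fill i b B n v).mem b' = s.mem b' := by simp [State.fill, h]

theorem State.fill_reg_of_ne {i b B n : ℕ} {v : ℕ → ℕ} {x : ℕ} (h : x ≠ i) :
    (s.fill i b B n v).reg x = s.reg x := by simp [State.fill, h]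

theorem State.fill_sameOut {i b B n : ℕ} {v : ℕ → ℕ} : SameOut s (s.fill i b B n v) := ⟨rfl, rfl⟩

theorem Runs.fill {i b n : ℕ} {base e : Expr} (B : ℕ) (v : ℕ → ℕ) (hi : 0 < i) (hn : s.reg 0 = n)
    (hnN : n ≤ N)
    (hB : ∀ s', (∀ x ≠ i, s'.reg x = s.reg x) → (∀ y ≠ b, s'.mem y = s.mem y) → base.eval s' = B)
    (he : ∀ j < n, ∀ s', s'.reg i = j → (∀ x ≠ i, s'.reg x = s.reg x) →
      (∀ y ≠ b, s'.mem y = s.mem y) → s'.mem b (B + j) = s.mem b (B + j) → e.eval s' = v j)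
    (hv : ∀ j < n, v j < 2 ^ N) (hQ : Q (s.fill i b B n v)) : Runs N (.fill i b base e) s Q := by
  refine Runs.loop n 0 (fun j s' => s' = s.fill i b B j v) hn hi hnN ?_ ?_ ?_
  · ext1
    · rfl
    · simp only [State.set_mem, State.fill, add_zero]
      ext b' a
      simp only [Function.update_apply]
      split_ifs <;> first | omega | simp_all
    · rfl
    · rfl
  · rintro j hj s' - hij rfl
    have h1 : ∀ x ≠ i, (s.fill i b B j v).reg x = s.reg x := fun x hx => State.fill_reg_of_ne hx
    have h2 : ∀ y ≠ b, (s.fill i b B j v).mem y = s.mem y := fun x hx => State.fill_mem_of_ne hx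
    have h3 := he j hj _ hij h1 h2 (by rw [State.fill_mem_self]; simp)
    have h4 := hB _ h1 h2
    refine Runs.write (by rw [h3]; exact hv j hj) ⟨⟨fun x _ => rfl, by simp⟩, ?_⟩
    rw [h3]
    simp only [Expr.eval_add, h4, Expr.eval_reg, hij]
    ext1
    · simp [State.set, State.store, State.fill]
    · ext b' a
      simp only [State.set_mem, State.store_mem, State.fill, Function.update_apply]
      by_cases hb : b' = b
      · subst hb
        by_cases ha : a = B + j
        · subst ha; simp
        · have : (B ≤ a ∧ a < B + j) ↔ (B ≤ a ∧ a < B + (j + 1)) := by omega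
          simp [ha, this]
      · simp [hb]
    · rfl
    · rfl
  · rintro s' - - rfl; exact hQ

end RAM

/-! ## Down-sets that generate an element -/

section DownSets

variable {X : Type*} (cl : ClosureOperator (Set X))

/-- A set is a down-set if it contains `cl {a}` for each of its elements `a`. -/
def IsDownSet (S : Set X) : Prop := ∀ a ∈ S, cl {a} ⊆ S

/-- `S` is a minimal down-set with `c ∈ cl S`. -/
def IsMinDown (c : X) (S : Set X) : Prop :=
  IsDownSet cl S ∧ c ∈ cl S ∧ ∀ T ⊆ S, IsDownSet cl T → c ∈ cl T → T = S

/-- The elements of `S` that are not below another element of `S`. -/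
def maxElems (S : Set X) : Set X := {a ∈ S | ∀ b ∈ S, b ≠ a → a ∉ cl {b}}

variable {cl}

theorem mem_closure_self (a : X) : a ∈ cl {a} := cl.le_closure {a} rfl

theorem closure_subset_of_mem {S : Set X} {a : X} (h : a ∈ cl S) : cl {a} ⊆ cl S := by
  have h1 : ({a} : Set X) ≤ cl S := Set.singleton_subset_iff.2 h
  have h2 := cl.monotone h1
  rwa [cl.idempotent] at h2

theorem mem_closure_trans {a b c : X} (h : b ∈ cl {a}) (h' : c ∈ cl {b}) : c ∈ cl {a} :=
  closure_subset_of_mem h h'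

theorem closure_subset_closure {S T : Set X} (h : S ⊆ cl T) : cl S ⊆ cl T := by
  have h2 := cl.monotone (show S ≤ cl T from h)
  rwa [cl.idempotent] at h2

theorem isDownSet_singleton (a : X) : IsDownSet cl (cl {a}) := fun _ h => closure_subset_of_mem h

theorem isDownSet_closure (S : Set X) : IsDownSet cl (cl S) := fun _ h => closure_subset_of_mem h

theorem isDownSet_binClosure (S : Set X) : IsDownSet cl (binClosure cl S) := by
  intro a ha
  simp only [binClosure, Set.mem_iUnion] at ha
  obtain ⟨b, hb, hab⟩ := ha
  intro x hx
  simp only [binClosure, Set.mem_iUnion]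
  exact ⟨b, hb, mem_closure_trans hab hx⟩

theorem IsDownSet.union {S T : Set X} (hS : IsDownSet cl S) (hT : IsDownSet cl T) :
    IsDownSet cl (S ∪ T) := by
  rintro a (h | h)
  · exact (hS a h).trans Set.subset_union_left
  · exact (hT a h).trans Set.subset_union_right

theorem subset_binClosure (S : Set X) : S ⊆ binClosure cl S := fun a ha => by
  simp only [binClosure, Set.mem_iUnion]
  exact ⟨a, ha, mem_closure_self a⟩

theorem binClosure_subset {S T : Set X} (hT : IsDownSet cl T) (h : S ⊆ T) :
    binClosure cl S ⊆ T := by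
  intro x hx
  simp only [binClosure, Set.mem_iUnion] at hx
  obtain ⟨a, ha, hxa⟩ := hx
  exact hT a (h ha) hxa

theorem closure_binClosure (S : Set X) : cl (binClosure cl S) = cl S :=
  Set.Subset.antisymm
    (closure_subset_closure (binClosure_subset (isDownSet_closure S) (cl.le_closure S)))
    (cl.monotone (subset_binClosure S))

theorem IsDownSet.diff {S : Set X} (hS : IsDownSet cl S) (x : X) :
    IsDownSet cl (S \ {a | x ∈ cl {a}}) := by
  rintro a ⟨ha, hxa⟩ b hb
  exact ⟨hS a ha hb, fun h => hxa (mem_closure_trans hb h)⟩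

/-- A down-set `S` with `c ∈ cl S` is minimal if no element can be removed. -/
theorem isMinDown_of_forall_diff {c : X} {S : Set X} (hS : IsDownSet cl S) (hc : c ∈ cl S)
    (h : ∀ x ∈ S, c ∉ cl (S \ {a | x ∈ cl {a}})) : IsMinDown cl c S := by
  refine ⟨hS, hc, fun T hT dT cT => hT.antisymm fun x hx => ?_⟩
  by_contra hxT
  have hTS : T ⊆ S \ {a | x ∈ cl {a}} := fun a ha => ⟨hT ha, fun hxa => hxT (dT a ha hxa)⟩
  exact h x hx (cl.monotone hTS cT)

theorem IsStandard.antisymm (hst : IsStandard cl) {a b : X} (h : b ∈ cl {a}) (h' : a ∈ cl {b}) :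
    a = b := by
  by_contra hne
  have hb : b ∈ cl {a} \ {a} := ⟨h, fun e => hne e.symm⟩
  have := (hst a).closure_eq
  have h2 : cl {b} ⊆ cl (cl {a} \ {a}) := closure_subset_of_mem (cl.le_closure _ hb)
  rw [this] at h2
  exact (h2 h').2 rfl

theorem IsStandard.isMinDown (hst : IsStandard cl) (c : X) : IsMinDown cl c (cl {c}) := by
  refine ⟨isDownSet_singleton c, cl.le_closure _ (mem_closure_self c), fun T hT dT cT => ?_⟩
  refine hT.antisymm (dT c ?_)
  by_contra hcT
  have h1 : T ⊆ cl {c} \ {c} := fun x hx => ⟨hT hx, fun e => hcT (e ▸ hx)⟩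
  have h2 := cl.monotone h1 cT
  rw [(hst c).closure_eq] at h2
  exact h2.2 rfl

theorem IsMinDown.eq_of_mem {c : X} {S : Set X} (h : IsMinDown cl c S) (hc : c ∈ S) :
    S = cl {c} :=
  (h.2.2 (cl {c}) (h.1 c hc) (isDownSet_singleton c) (cl.le_closure _ (mem_closure_self c))).symm

theorem exists_isMinGen_subset [Finite X] {S : Set X} {c : X} (h : c ∈ cl S) :
    ∃ A ⊆ S, IsMinGen cl A c := by
  have hfin : {A : Set X | A ⊆ S ∧ c ∈ cl A}.Finite := Set.toFinite _
  obtain ⟨A, hA⟩ := hfin.exists_minimal ⟨S, subset_rfl, h⟩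
  refine ⟨A, hA.prop.1, hA.prop.2, fun A' hA' hc => ?_⟩
  exact hA'.2 (hA.le_of_le ⟨hA'.1.trans hA.prop.1, hc⟩ hA'.1)

theorem binClosure_maxElems [Finite X] (hst : IsStandard cl) {S : Set X} (hS : IsDownSet cl S) :
    binClosure cl (maxElems cl S) = S := by
  refine (binClosure_subset hS fun a ha => ha.1).antisymm fun x hx => ?_
  have hfin : {A : Set X | ∃ a ∈ S, x ∈ cl {a} ∧ A = cl {a}}.Finite := Set.toFinite _
  obtain ⟨A, hA⟩ := hfin.exists_maximal ⟨_, x, hx, mem_closure_self x, rfl⟩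
  obtain ⟨a, ha, hxa, rfl⟩ := hA.prop
  simp only [binClosure, Set.mem_iUnion]
  refine ⟨a, ⟨ha, fun b hb hne hab => hne ?_⟩, hxa⟩
  have h1 : cl {b} ≤ cl {a} :=
    hA.le_of_ge ⟨b, hb, mem_closure_trans hab hxa, rfl⟩ (closure_subset_of_mem hab)
  exact hst.antisymm hab (h1 (mem_closure_self b))

theorem maxElems_binClosure {A : Set X} {c : X} (hst : IsStandard cl) (hA : IsMinGen cl A c) :
    maxElems cl (binClosure cl A) = A := by
  ext x
  constructor
  · rintro ⟨hx, hmax⟩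
    simp only [binClosure, Set.mem_iUnion] at hx
    obtain ⟨a, ha, hxa⟩ := hx
    by_cases hax : a = x
    · exact hax ▸ ha
    · exact absurd hxa (hmax a (subset_binClosure A ha) hax)
  · intro hx
    refine ⟨subset_binClosure A hx, fun b hb hne hxb => ?_⟩
    simp only [binClosure, Set.mem_iUnion] at hb
    obtain ⟨a, ha, hba⟩ := hb
    have hxa : x ∈ cl {a} := mem_closure_trans hba hxb
    have hax : a ≠ x := by
      rintro rfl
      exact hne (hst.antisymm hba hxb).symm
    refine hA.2 (A \ {x}) ⟨Set.sdiff_subset, fun h => (h hx).2 rfl⟩ ?_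
    refine closure_subset_closure (fun y hy => ?_) hA.1
    by_cases hyx : y = x
    · subst hyx
      exact cl.monotone (Set.singleton_subset_iff.2 (⟨ha, hax⟩ : a ∈ A \ {y})) hxa
    · exact cl.le_closure _ ⟨hy, hyx⟩

/-- The `D`-generators of `c` are the sets of maximal elements of the minimal down-sets that
generate `c` and do not contain `c`. -/
theorem isDGen_iff [Finite X] (hst : IsStandard cl) {A : Set X} {c : X} :
    IsDGen cl A c ↔ ∃ S, IsMinDown cl c S ∧ c ∉ S ∧ maxElems cl S = A := by
  constructor
  · rintro ⟨hmin, hc, huniq⟩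
    refine ⟨binClosure cl A, ⟨isDownSet_binClosure A, ?_, fun T hT dT cT => ?_⟩, hc,
      maxElems_binClosure hst hmin⟩
    · rw [closure_binClosure]; exact hmin.1
    · obtain ⟨A', hA', hg⟩ := exists_isMinGen_subset cT
      have := huniq A' hg (hA'.trans hT)
      subst this
      exact hT.antisymm (binClosure_subset dT hA')
  · rintro ⟨S, hS, hc, rfl⟩
    have hb := binClosure_maxElems hst hS.1
    have hsub : ∀ A', A' ⊆ S → c ∈ cl A' → maxElems cl S ⊆ A' := by
      intro A' hA' hcA' a ha
      have hbA' : binClosure cl A' = S :=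
        hS.2.2 _ (binClosure_subset hS.1 hA') (isDownSet_binClosure A')
          (by rwa [closure_binClosure])
      have : a ∈ binClosure cl A' := hbA'.symm ▸ ha.1
      simp only [binClosure, Set.mem_iUnion] at this
      obtain ⟨b, hb', hab⟩ := this
      by_cases hba : b = a
      · exact hba ▸ hb'
      · exact absurd hab (ha.2 b (hA' hb') hba)
    have hg : IsMinGen cl (maxElems cl S) c := by
      refine ⟨?_, fun A' hA' hcA' => hA'.2 (hsub A' (hA'.1.trans fun a ha => ha.1) hcA')⟩
      rw [← closure_binClosure, hb]; exact hS.2.1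
    refine ⟨hg, by rwa [hb], fun A' hA' hsubA' => ?_⟩
    rw [hb] at hsubA'
    by_contra hne
    exact hA'.2 _ ((hsub A' hsubA' hA'.1).ssubset_of_ne (Ne.symm hne)) hg.1

end DownSets

section Traversal

variable {X : Type*} {imps : List (Implication X)}

theorem isClosed_impClosure_iff {S : Set X} : (impClosure imps).IsClosed S ↔ IsModel imps S :=
  Iff.rfl

theorem isModel_impClosure (S : Set X) : IsModel imps (impClosure imps S) :=
  isClosed_impClosure_iff.1 ((impClosure imps).isClosed_closure S)

theorem impClosure_subset {S T : Set X} (h : S ⊆ T) (hT : IsModel imps T) :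
    impClosure imps S ⊆ T :=
  ClosureOperator.closure_min h (isClosed_impClosure_iff.2 hT)

/-- The down-set obtained from `S` by replacing the elements below the conclusion of `I` by the
premise of `I`. -/
def neighbor (imps : List (Implication X)) (I : Implication X) (S : Set X) : Set X :=
  binClosure (impClosure imps) ((S \ impClosure imps {I.concl}) ∪ I.prem)

theorem mem_closure_neighbor {I : Implication X} (hI : I ∈ imps) {S : Set X} {c : X}
    (hc : c ∈ impClosure imps S) : c ∈ impClosure imps (neighbor imps I S) := by
  rw [neighbor, closure_binClosure]
  refine closure_subset_closure (fun x hx => ?_) hc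
  by_cases h : x ∈ impClosure imps {I.concl}
  · refine closure_subset_of_mem (isModel_impClosure _ I hI ?_) h
    exact Set.subset_union_right.trans ((impClosure imps).le_closure _)
  · exact (impClosure imps).le_closure _ (Or.inl ⟨hx, h⟩)

/-- The down-sets between `T` and its closure that are obtained by forward chaining. -/
inductive Chained (imps : List (Implication X)) (T : Set X) : Set X → Prop
  | base : Chained imps T T
  | step (I : Implication X) (U : Set X) : I ∈ imps → (I.prem : Set X) ⊆ U → Chained imps T U →
      Chained imps T (U ∪ impClosure imps {I.concl})

theorem Chained.isDownSet {T U : Set X} (hT : IsDownSet (impClosure imps) T)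
    (h : Chained imps T U) : IsDownSet (impClosure imps) U := by
  induction h with
  | base => exact hT
  | step I U _ _ _ ih => exact ih.union (isDownSet_singleton _)

theorem Chained.subset {T U : Set X} (h : Chained imps T U) : T ⊆ U := by
  induction h with
  | base => exact subset_rfl
  | step I U _ _ _ ih => exact ih.trans Set.subset_union_left

theorem exists_chained_isModel [Finite X] (T : Set X) :
    ∃ U, Chained imps T U ∧ IsModel imps U := by
  have hfin : {U : Set X | Chained imps T U}.Finite := Set.toFinite _
  obtain ⟨U, hU⟩ := hfin.exists_maximal ⟨T, .base⟩
  refine ⟨U, hU.prop, fun I hI hsub => ?_⟩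
  exact hU.le_of_ge (Chained.step I U hI hsub hU.prop) Set.subset_union_left
    (Or.inr (mem_closure_self _))

/-- A set of minimal down-sets that generate `c`, which contains `cl {c}` and is closed under
passing to (a minimal part of) neighbors, consists of all of them. -/
theorem mem_of_neighbor_closed [Finite X] {c : X} {L : Set (Set X)}
    (hL : ∀ S ∈ L, IsMinDown (impClosure imps) c S) (h0 : impClosure imps {c} ∈ L)
    (hnb : ∀ S ∈ L, ∀ I ∈ imps, ∃ S' ∈ L, S' ⊆ neighbor imps I S)
    {T : Set X} (hT : IsMinDown (impClosure imps) c T) : T ∈ L := by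
  have key : ∀ U, Chained imps T U → (∃ S ∈ L, S ⊆ U) → T ∈ L := by
    intro U hU
    induction hU with
    | base =>
      rintro ⟨S, hS, hST⟩
      exact hT.2.2 S hST (hL S hS).1 (hL S hS).2.1 ▸ hS
    | step I U hI hsub hch ih =>
      rintro ⟨S, hS, hSU⟩
      obtain ⟨S', hS', hsub'⟩ := hnb S hS I hI
      refine ih ⟨S', hS', hsub'.trans (binClosure_subset (hch.isDownSet hT.1) ?_)⟩
      rintro x (⟨hx, hx'⟩ | hx)
      · exact (hSU hx).resolve_right hx'
      · exact hsub hx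
  obtain ⟨U, hU, hm⟩ := exists_chained_isModel (imps := imps) T
  refine key U hU ⟨_, h0, impClosure_subset ?_ hm⟩
  exact Set.singleton_subset_iff.2 (impClosure_subset hU.subset hm hT.2.1)

end Traversal

/-! ## Representation of sets and of the input -/

section Representation

variable {n : ℕ}

open Classical in
/-- The characteristic function of a set of elements of `Fin n`. -/
noncomputable def ind (S : Set (Fin n)) (j : ℕ) : ℕ := if ∃ i ∈ S, (i : ℕ) = j then 1 else 0

theorem ind_val (S : Set (Fin n)) [DecidablePred (· ∈ S)] (i : Fin n) :
    ind S i = if i ∈ S then 1 else 0 := by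
  have : (∃ i' ∈ S, (i' : ℕ) = i) ↔ i ∈ S :=
    ⟨fun ⟨i', h, e⟩ => Fin.ext e ▸ h, fun h => ⟨i, h, rfl⟩⟩
  simp only [ind, this]

theorem ind_of_mem {S : Set (Fin n)} {i : Fin n} (h : i ∈ S) : ind S i = 1 := by
  classical simp [ind_val, h]

theorem ind_of_notMem {S : Set (Fin n)} {i : Fin n} (h : i ∉ S) : ind S i = 0 := by
  classical simp [ind_val, h]

theorem ind_ne_zero {S : Set (Fin n)} {i : Fin n} : ind S i ≠ 0 ↔ i ∈ S := by
  classical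
  rw [ind_val]; split_ifs with h <;> simp [h]

theorem ind_eq_zero {S : Set (Fin n)} {i : Fin n} : ind S i = 0 ↔ i ∉ S := by
  rw [← ind_ne_zero, not_not]

theorem ind_le_one (S : Set (Fin n)) (j : ℕ) : ind S j ≤ 1 := by
  classical rw [ind]; split_ifs <;> omega

theorem ind_lt {N : ℕ} (hN : 0 < N) (S : Set (Fin n)) (j : ℕ) : ind S j < 2 ^ N :=
  (ind_le_one S j).trans_lt (Nat.one_lt_two_pow (by omega))

/-- The cells `B, ..., B + n - 1` contain the characteristic function of `S`. -/
def Holds (f : ℕ → ℕ) (B : ℕ) (S : Set (Fin n)) : Prop := ∀ i : Fin n, f (B + i) = ind S i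

theorem Holds.zero {f : ℕ → ℕ} {S : Set (Fin n)} (h : Holds f 0 S) (i : Fin n) :
    f i = ind S i := by simpa using h i

theorem Holds.update_one {f : ℕ → ℕ} {S : Set (Fin n)} (h : Holds f 0 S) (i : Fin n) :
    Holds (Function.update f i 1) 0 (insert i S) := by
  classical
  intro j
  rw [Function.update_apply, zero_add]
  split_ifs with hij
  · rw [ind_of_mem]; exact Or.inl (Fin.ext hij)
  · rw [h.zero, ind_val, ind_val]
    refine if_congr ?_ rfl rfl
    rw [Set.mem_insert_iff, or_iff_right]
    rintro rfl; exact hij rfl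

/-- The position of the `j`-th implication in the encoding of an implicational base. -/
def impPos (imps : List (Implication (Fin n))) (j : ℕ) : ℕ :=
  2 + ((imps.take j).map fun I => 2 + I.prem.card).sum

theorem impPos_succ (imps : List (Implication (Fin n))) {j : ℕ} (hj : j < imps.length) :
    impPos imps (j + 1) = impPos imps j + 2 + imps[j].prem.card := by
  simp only [impPos, List.take_succ_eq_append_getElem hj, List.map_append, List.map_cons,
    List.map_nil, List.sum_append, List.sum_cons, List.sum_nil]
  omega

theorem impPos_le_size (imps : List (Implication (Fin n))) (j : ℕ) :
    impPos imps j ≤ 2 * sizeIB n imps + 2 := by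
  have key : ∀ l : List (Implication (Fin n)), ∀ j, ((l.take j).map fun I => 2 + I.prem.card).sum
      ≤ 2 * (l.map fun I => I.prem.card + 1).sum := by
    intro l
    induction l with
    | nil => simp
    | cons I l ih =>
      intro j
      cases j with
      | zero => simp
      | succ j => have := ih j; simp only [List.take_succ_cons, List.map_cons, List.sum_cons]; omega
  have := key imps j
  simp only [impPos, sizeIB]; omega

theorem length_le_size (imps : List (Implication (Fin n))) : imps.length ≤ sizeIB n imps := by
  have key : ∀ l : List (Implication (Fin n)), l.length ≤ (l.map fun I => I.prem.card + 1).sum := by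
    intro l
    induction l with
    | nil => simp
    | cons I l ih => simp only [List.length_cons, List.map_cons, List.sum_cons]; omega
  exact (key imps).trans (Nat.le_add_left _ _)

/-- The cells of `f` contain the encoding of the implicational base. -/
structure IsInput (f : ℕ → ℕ) (imps : List (Implication (Fin n))) : Prop where
  ground : f 0 = n
  count : f 1 = imps.length
  concl : ∀ j (hj : j < imps.length), f (impPos imps j) = imps[j].concl
  card : ∀ j (hj : j < imps.length), f (impPos imps j + 1) = imps[j].prem.card
  prem : ∀ j (hj : j < imps.length) i, i < imps[j].prem.card →
    ∃ a ∈ imps[j].prem, f (impPos imps j + 2 + i) = a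
  exists_of_mem_prem : ∀ j (hj : j < imps.length), ∀ a ∈ imps[j].prem,
    ∃ i < imps[j].prem.card, f (impPos imps j + 2 + i) = a

theorem getD_flatMap_encodeImplication (imps : List (Implication (Fin n))) :
    ∀ j (hj : j < imps.length) i, i < 2 + imps[j].prem.card →
      (imps.flatMap encodeImplication).getD (impPos imps j - 2 + i) 0 =
        (encodeImplication imps[j]).getD i 0 := by
  induction imps with
  | nil => intro j hj; simp at hj
  | cons I l ih =>
    have hlen : (encodeImplication I).length = 2 + I.prem.card := by
      simp [encodeImplication]; omega
    intro j hj i hi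
    cases j with
    | zero =>
      have hi' : i < (encodeImplication I).length := by rw [hlen]; exact hi
      simp only [impPos, List.take_zero, List.map_nil, List.sum_nil, List.flatMap_cons,
        List.getElem_cons_zero]
      rw [List.getD_append _ _ _ _ (by simpa using hi')]
      simp
    | succ j =>
      have hj' : j < l.length := by simpa using hj
      have h := ih j hj' i (by simpa using hi)
      simp only [List.getElem_cons_succ]
      rw [← h, List.flatMap_cons]
      have hpos : impPos (I :: l) (j + 1) - 2 + i =
          (encodeImplication I).length + (impPos l j - 2 + i) := by
        rw [hlen]; simp [impPos]; omega
      rw [hpos, List.getD_append_right _ _ _ _ (Nat.le_add_right _ _), Nat.add_sub_cancel_left]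

theorem isInput_encodeIB (imps : List (Implication (Fin n))) :
    IsInput (fun i => (encodeIB n imps).getD i 0) imps := by
  have key : ∀ j (hj : j < imps.length) i, i < 2 + imps[j].prem.card →
      (encodeIB n imps).getD (impPos imps j + i) 0 = (encodeImplication imps[j]).getD i 0 := by
    intro j hj i hi
    rw [← getD_flatMap_encodeImplication imps j hj i hi]
    have : impPos imps j + i = (impPos imps j - 2 + i) + 1 + 1 := by simp [impPos]; omega
    rw [this, encodeIB, List.getD_cons_succ, List.getD_cons_succ]
  have hprem : ∀ j (hj : j < imps.length) i (hi : i < imps[j].prem.card),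
      (encodeIB n imps).getD (impPos imps j + 2 + i) 0 =
        (imps[j].prem.sort[i]'(by simpa using hi) : ℕ) := by
    intro j hj i hi
    rw [add_assoc, key j hj (2 + i) (by omega), add_comm 2 i, encodeImplication,
      List.getD_cons_succ, List.getD_cons_succ, List.getD_eq_getElem _ _ (by simpa using hi),
      List.getElem_map]
  refine ⟨rfl, rfl, fun j hj => ?_, fun j hj => ?_, fun j hj i hi => ?_, fun j hj a ha => ?_⟩
  · exact key j hj 0 (by omega)
  · exact key j hj 1 (by omega)
  · refine ⟨imps[j].prem.sort[i]'(by simpa using hi), ?_, hprem j hj i hi⟩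
    have := List.getElem_mem (l := imps[j].prem.sort) (n := i) (by simpa using hi)
    exact (Finset.mem_sort _).1 this
  · have : a ∈ imps[j].prem.sort := by simpa using ha
    obtain ⟨i, hi, e⟩ := List.mem_iff_getElem.1 this
    have hi' : i < imps[j].prem.card := by simpa using hi
    refine ⟨i, hi', ?_⟩
    rw [← e]; exact hprem j hj i hi'

end Representation

namespace RAM

variable {n N : ℕ} {imps : List (Implication (Fin n))} {s : State} {Q : State → Prop}

/-- The bit length `N` suffices for all numbers of the size of the input. -/
structure Ample (N : ℕ) (imps : List (Implication (Fin n))) : Prop where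
  ground : n + 1 ≤ N
  count : imps.length ≤ N
  pos : ∀ j, impPos imps j ≤ N

theorem Ample.pos_bits (h : Ample N imps) : 0 < N := by have := h.ground; omega

theorem Ample.one_lt (h : Ample N imps) : 1 < 2 ^ N := Nat.one_lt_two_pow h.pos_bits.ne'

theorem Ample.card (_ : Ample N imps) {I : Implication (Fin n)} : I.prem.card ≤ n := by
  simpa using I.prem.card_le_univ

theorem lt_two_pow_of_le {a : ℕ} (h : a ≤ N) : a < 2 ^ N := h.trans_lt Nat.lt_two_pow_self

/-- The first two registers and the first bank contain the input. -/
structure HasInput (imps : List (Implication (Fin n))) (s : State) : Prop where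
  ground : s.reg 0 = n
  count : s.reg 1 = imps.length
  input : IsInput (s.mem 0) imps

theorem HasInput.frame {s' : State} {r b : ℕ} (h : HasInput imps s) (f : Frame r b s s')
    (hr : 2 ≤ r := by omega) (hb : 1 ≤ b := by omega) : HasInput imps s' :=
  ⟨(f.1 0 (by omega)).trans h.ground, (f.1 1 (by omega)).trans h.count,
    (f.2 0 (by omega)).symm ▸ h.input⟩

/-- Run `P` for each implication, with the position of the implication in register `i + 1`. -/
def Prog.scan (i : ℕ) (P : Prog) : Prog :=
  .seq (.assign (i + 1) (.const 2)) (.loop i 1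
    (.seq P (.assign (i + 1)
      (.add (.add (.reg (i + 1)) (.const 2)) (.read 0 (.add (.reg (i + 1)) (.const 1)))))))

theorem Runs.scan {i : ℕ} {P : Prog} (b : ℕ) (Inv : ℕ → State → Prop) (hN : Ample N imps)
    (hs : HasInput imps s) (hi : 2 ≤ i) (hb : 1 ≤ b)
    (hInv : ∀ j s x v, i ≤ x → Inv j s → Inv j (s.set x v)) (h0 : Inv 0 s)
    (step : ∀ j (_ : j < imps.length) s', Frame i b s s' → HasInput imps s' →
      s'.reg (i + 1) = impPos imps j → Inv j s' →
      Runs N P s' fun s'' => Frame (i + 2) b s' s'' ∧ SameOut s' s'' ∧ Inv (j + 1) s'')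
    (hQ : ∀ s', Frame i b s s' → SameOut s s' → Inv imps.length s' → Q s') :
    Runs N (.scan i P) s Q := by
  have f0 : Frame i b s (s.set (i + 1) 2) := Frame.set
  refine Runs.seq (Runs.assign (lt_two_pow_of_le (by have := hN.pos 0; simp [impPos] at this; simpa))
    (Runs.loop' imps.length b (fun j s' => s'.reg (i + 1) = impPos imps j ∧ Inv j s')
      (hs.frame f0).count (by omega) hN.count ⟨?_, ?_⟩ ?_ ?_))
  · simp [State.set_reg, impPos]
  · exact hInv _ _ _ _ le_rfl (hInv _ _ _ _ (by omega) h0)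
  · intro j hj s' f hij ⟨hp, inv⟩
    refine Runs.seq ((step j hj s' (f0.trans f) (hs.frame (f0.trans f)) hp inv).mono ?_)
    rintro s'' ⟨f', o', inv'⟩
    have hs'' := hs.frame ((f0.trans f).trans f')
    have hp' : s''.reg (i + 1) = impPos imps j := (f'.1 _ (by omega)).trans hp
    have hval : (Expr.add (.add (.reg (i + 1)) (.const 2))
        (.read 0 (.add (.reg (i + 1)) (.const 1)))).eval s'' = impPos imps (j + 1) := by
      simp [hp', hs''.input.card j hj, impPos_succ imps hj]
    refine Runs.assign ?_ ⟨?_, ?_, ?_, ?_⟩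
    · rw [hval]; exact lt_two_pow_of_le (hN.pos _)
    · exact (f'.mono (by omega) le_rfl).then_set
    · exact o'.trans ⟨rfl, rfl⟩
    · rw [State.set_reg_of_ne (by omega), hval]; simp
    · exact hInv _ _ _ _ le_rfl (hInv _ _ _ _ (by omega) inv')
  · intro s' f o inv
    exact hQ s' (f0.trans f) (SameOut.trans ⟨rfl, rfl⟩ o) inv.2

/-- Apply the implication at the position in register `32` to the set in bank `7`. -/
def closureStepProg : Prog :=
  .seq (.assign 33 (.read 0 (.add (.reg 32) (.const 1))))
  (.seq (.assign 35 (.const 1))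
  (.seq (.loop 34 33
    (.ite (.read 7 (.read 0 (.add (.add (.reg 32) (.const 2)) (.reg 34)))) .skip
      (.assign 35 (.const 0))))
  (.ite (.reg 35) (.write 7 (.read 0 (.reg 32)) (.const 1)) .skip)))

/-- Replace the set in bank `7` by its closure. -/
def closureProg : Prog := .loop 30 0 (.scan 31 closureStepProg)

theorem runs_closureStepProg (hN : Ample N imps) (hs : HasInput imps s) {j : ℕ}
    (hj : j < imps.length) (hp : s.reg 32 = impPos imps j) {U : Set (Fin n)}
    (hU : Holds (s.mem 7) 0 U) :
    Runs N closureStepProg s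
      fun s' => Frame 33 7 s s' ∧ SameOut s s' ∧
        ∃ U', Holds (s'.mem 7) 0 U' ∧ U ⊆ U' ∧ (U' = U ∨ (imps[j].prem : Set (Fin n)) ⊆ U) ∧
          U' ⊆ insert imps[j].concl U ∧ ((imps[j].prem : Set (Fin n)) ⊆ U → imps[j].concl ∈ U') := by
  have hcard : (Expr.read 0 (.add (.reg 32) (.const 1))).eval s = imps[j].prem.card := by
    simp [hp, hs.input.card j hj]
  have hcN : imps[j].prem.card ≤ N := hN.card.trans (by have := hN.ground; omega)
  refine Runs.seq (Runs.assign (by rw [hcard]; exact lt_two_pow_of_le hcN) ?_)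
  rw [hcard]
  refine Runs.seq (Runs.assign hN.one_lt ?_)
  set s₁ := (s.set 33 imps[j].prem.card).set 35 1
  have f₁ : Frame 33 8 s s₁ := Frame.rfl.then_set.then_set
  have o₁ : SameOut s s₁ := ⟨rfl, rfl⟩
  refine Runs.seq (Runs.loop' imps[j].prem.card 8
    (fun i s' => s'.reg 35 ≤ 1 ∧ (s'.reg 35 ≠ 0 ↔ ∀ i' < i, s.mem 7 (s.mem 0 (impPos imps j + 2 + i')) ≠ 0))
    (by simp [State.set_reg]) (by omega) hcN (by simp [State.set_reg]) ?_ ?_)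
  · intro i hi s' f' hi' ⟨hle, hinv⟩
    have hval : (Expr.read 7 (.read 0 (.add (.add (.reg 32) (.const 2)) (.reg 34)))).eval s' =
        s.mem 7 (s.mem 0 (impPos imps j + 2 + i)) := by
      have e0 := (f₁.trans f' (by omega) le_rfl).2 0 (by omega)
      have e6 := (f₁.trans f' (by omega) le_rfl).2 7 (by omega)
      have er := (f₁.trans f' (by omega) le_rfl).1 32 (by omega)
      simp [e0, e6, er, hp, hi']
    refine Runs.ite (fun h => Runs.skip ⟨.rfl, .rfl, ?_⟩) (fun h => Runs.assign ?_ ⟨?_, ⟨rfl, rfl⟩, ?_⟩)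
    · rw [hval] at h
      simp only [State.set_reg_of_ne (show (35 : ℕ) ≠ 34 by omega), Nat.forall_lt_succ_right, hinv]
      exact ⟨hle, by simp [h]⟩
    · simp
    · exact Frame.set
    · rw [hval] at h
      simp only [State.set_reg_of_ne (show (35 : ℕ) ≠ 34 by omega), Nat.forall_lt_succ_right]
      simp [h]
  · rintro s₂ f₂ o₂ ⟨-, hinv⟩
    have f := f₁.trans f₂ (by omega) le_rfl
    have hprem : s₂.reg 35 ≠ 0 ↔ (imps[j].prem : Set (Fin n)) ⊆ U := by
      rw [hinv]
      constructor
      · intro h a ha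
        obtain ⟨i, hi, e⟩ := hs.input.exists_of_mem_prem j hj a ha
        have := h i hi
        rw [e, hU.zero, ind_ne_zero] at this
        exact this
      · intro h i hi
        obtain ⟨a, ha, e⟩ := hs.input.prem j hj i hi
        rw [e, hU.zero, ind_ne_zero]
        exact h ha
    have hU₂ : Holds (s₂.mem 7) 0 U := by rw [f.2 7 (by omega)]; exact hU
    refine Runs.ite (fun h => Runs.write (by simpa using hN.one_lt) ⟨?_, ?_, ?_⟩)
      (fun h => Runs.skip ⟨f.mono, o₁.trans o₂, ?_⟩)
    · exact f.mono.then_store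
    · exact (o₁.trans o₂).trans ⟨rfl, rfl⟩
    · have hsub := hprem.1 h
      refine ⟨insert imps[j].concl U, ?_, Set.subset_insert _ _, Or.inr hsub, subset_rfl,
        fun _ => Set.mem_insert _ _⟩
      have : (Expr.read 0 (.reg 32)).eval s₂ = imps[j].concl := by
        simp [f.1 32 (by omega), f.2 0 (by omega), hp, hs.input.concl j hj]
      rw [this, State.store_mem, if_pos rfl]
      exact hU₂.update_one _
    · refine ⟨U, hU₂, subset_rfl, Or.inl rfl, Set.subset_insert _ _, fun hsub => ?_⟩
      exact absurd h (hprem.2 hsub)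

theorem runs_closureProg (hN : Ample N imps) (hs : HasInput imps s) {S : Set (Fin n)}
    (hS : Holds (s.mem 7) 0 S) :
    Runs N closureProg s fun s' => Frame 30 7 s s' ∧ SameOut s s' ∧
      Holds (s'.mem 7) 0 (impClosure imps S) := by
  refine Runs.loop' n 7 (fun r s' => ∃ U, Holds (s'.mem 7) 0 U ∧ S ⊆ U ∧ U ⊆ impClosure imps S ∧
    (IsModel imps U ∨ r ≤ U.ncard)) hs.ground (by omega) (by have := hN.ground; omega)
    ⟨S, hS, subset_rfl, (impClosure imps).le_closure S, Or.inr (Nat.zero_le _)⟩ ?_ ?_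
  · intro r hr s₁ f₁ _ ⟨U, hU, hSU, hUS, hr'⟩
    have hs₁ := hs.frame f₁
    refine Runs.scan 7 (fun j s' => ∃ U', Holds (s'.mem 7) 0 U' ∧ U ⊆ U' ∧
      U' ⊆ impClosure imps S ∧ ∀ j' < j, ∀ hj : j' < imps.length,
        (imps[j'].prem : Set (Fin n)) ⊆ U → imps[j'].concl ∈ U') hN hs₁ (by omega) (by omega)
      (fun j s x v _ h => h) ⟨U, hU, subset_rfl, hUS, fun _ h => absurd h (Nat.not_lt_zero _)⟩ ?_ ?_
    · intro j hj s₂ f₂ hs₂ hp ⟨U₁, hU₁, hUU₁, hU₁S, hmod⟩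
      refine (runs_closureStepProg hN hs₂ hj hp hU₁).mono ?_
      rintro s₃ ⟨f₃, o₃, U₂, hU₂, h1, h2, h3, h4⟩
      refine ⟨f₃, o₃, U₂, hU₂, hUU₁.trans h1, ?_, fun j' hj' hlt hsub => ?_⟩
      · rcases h2 with rfl | h2
        · exact hU₁S
        · refine h3.trans (Set.insert_subset ?_ hU₁S)
          exact isModel_impClosure S _ (List.getElem_mem hj) (h2.trans hU₁S)
      · rcases Nat.lt_succ_iff_lt_or_eq.1 hj' with h | rfl
        · exact h1 (hmod j' h hlt hsub)
        · exact h4 (hsub.trans hUU₁)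
    · rintro s₂ f₂ o₂ ⟨U', hU', hUU', hU'S, hmod⟩
      refine ⟨f₂, o₂, U', hU', hSU.trans hUU', hU'S, ?_⟩
      by_cases hm : IsModel imps U'
      · exact Or.inl hm
      · right
        have hne : U ≠ U' := by
          rintro rfl
          refine hm fun I hI hsub => ?_
          obtain ⟨j, hj, rfl⟩ := List.mem_iff_getElem.1 hI
          exact hmod j hj hj hsub
        have hlt : U.ncard < U'.ncard := Set.ncard_lt_ncard (hUU'.ssubset_of_ne hne) (Set.toFinite _)
        rcases hr' with hm' | hr'
        · refine absurd (hUU'.antisymm ?_) hne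
          exact hU'S.trans (impClosure_subset hSU hm')
        · omega
  · rintro s' f o ⟨U, hU, hSU, hUS, hr⟩
    refine ⟨f, o, ?_⟩
    have hm : IsModel imps U := by
      rcases hr with h | h
      · exact h
      · have : U = Set.univ := by
          refine Set.eq_of_subset_of_ncard_le (Set.subset_univ _) ?_ (Set.toFinite _)
          simpa [Set.ncard_univ] using h
        rw [this]; exact fun _ _ _ => trivial
    rw [(impClosure_subset hSU hm).antisymm hUS]
    exact hU

end RAM

section Mask

variable {n : ℕ}

/-- The number whose binary digits are the first `j` values of the characteristic function. -/
noncomputable def mask (S : Set (Fin n)) : ℕ → ℕ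
  | 0 => 0
  | j + 1 => mask S j + mask S j + ind S j

theorem mask_lt (S : Set (Fin n)) (j : ℕ) : mask S j < 2 ^ j := by
  induction j with
  | zero => simp [mask]
  | succ j ih => have := ind_le_one S j; rw [mask, pow_succ]; omega

theorem ind_eq_of_mask_eq {S T : Set (Fin n)} {k : ℕ} (h : mask S k = mask T k) :
    ∀ j < k, ind S j = ind T j := by
  induction k with
  | zero => intro j hj; omega
  | succ k ih =>
    have h1 := ind_le_one S k
    have h2 := ind_le_one T k
    simp only [mask] at h
    intro j hj
    rcases Nat.lt_succ_iff_lt_or_eq.1 hj with hj | rfl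
    · exact ih (by omega) j hj
    · omega

theorem mask_injective {S T : Set (Fin n)} (h : mask S n = mask T n) : S = T := by
  ext i
  rw [← ind_ne_zero, ← ind_ne_zero (S := T), ind_eq_of_mask_eq h i i.2]

end Mask

namespace RAM

variable {n N : ℕ} {imps : List (Implication (Fin n))} {s : State} {Q : State → Prop}

theorem Runs.fillSet {i b : ℕ} {base e : Expr} (B : ℕ) (T : Set (Fin n)) (hi : 0 < i)
    (hn : s.reg 0 = n) (hnN : n + 1 ≤ N)
    (hB : ∀ s', (∀ x ≠ i, s'.reg x = s.reg x) → (∀ y ≠ b, s'.mem y = s.mem y) → base.eval s' = B)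
    (he : ∀ (j : Fin n) (s' : State), s'.reg i = j → (∀ x ≠ i, s'.reg x = s.reg x) →
      (∀ y ≠ b, s'.mem y = s.mem y) → s'.mem b (B + j) = s.mem b (B + j) → e.eval s' = ind T j)
    (hQ : Q (s.fill i b B n (ind T))) : Runs N (.fill i b base e) s Q :=
  Runs.fill B (ind T) hi hn (by omega) hB (fun j hj => he ⟨j, hj⟩)
    (fun j _ => ind_lt (by omega) T j) hQ

theorem State.fill_holds {i b B : ℕ} (T : Set (Fin n)) :
    Holds ((s.fill i b B n (ind T)).mem b) B T := fun j => by
  rw [State.fill_mem_self, if_pos ⟨by omega, by omega⟩, Nat.add_sub_cancel_left]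

theorem State.fill_holds_of_disjoint {i b B B' : ℕ} {v : ℕ → ℕ} {S : Set (Fin n)}
    (h : Holds (s.mem b) B' S) (hB : B' + n ≤ B ∨ B + n ≤ B') :
    Holds ((s.fill i b B n v).mem b) B' S := fun j => by
  rw [State.fill_mem_self, if_neg (by omega), h j]

theorem slot_disjoint {i j : ℕ} (n : ℕ) (h : i ≠ j) : i * n + n ≤ j * n ∨ j * n + n ≤ i * n := by
  rcases Nat.lt_or_gt_of_ne h with h | h
  · left; have := Nat.mul_le_mul_right n h; rw [Nat.succ_mul] at this; exact this
  · right; have := Nat.mul_le_mul_right n h; rw [Nat.succ_mul] at this; exact this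

/-- Bank `1` contains, besides the input in bank `0`, the closures of the elements. -/
structure Ready (imps : List (Implication (Fin n))) (s : State) : Prop extends
    HasInput imps s where
  matrix : ∀ a : Fin n, Holds (s.mem 1) (a * n) (impClosure imps {a})

theorem Ready.frame {s' : State} {r b : ℕ} (h : Ready imps s) (f : Frame r b s s')
    (hr : 2 ≤ r := by omega) (hb : 2 ≤ b := by omega) : Ready imps s' :=
  ⟨h.toHasInput.frame f, fun a => by rw [f.2 1 (by omega)]; exact h.matrix a⟩

/-- The cell of bank `1` that tells whether the second element is in the closure of the first. -/
def Expr.inClosure (a b : Expr) : Expr := .read 1 (.add (.mul a (.reg 0)) b)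

theorem Ready.eval_inClosure (h : Ready imps s) {a b : Expr} {x y : Fin n} (ha : a.eval s = x)
    (hb : b.eval s = y) : (Expr.inClosure a b).eval s = ind (impClosure imps {x}) y := by
  simp [Expr.inClosure, ha, hb, h.ground, h.matrix x y]

/-! ### Minimization -/

/-- The characteristic function, at register `21`, of the set in bank `6` without the elements
above register `20`. -/
def removeExpr : Expr :=
  .mul (.read 6 (.reg 21)) (.sub (.const 1) (.inClosure (.reg 21) (.reg 20)))

/-- Replace the down-set in bank `6`, the closure of which contains register `2`, by a minimal
one. -/
def minimizeProg : Prog :=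
  .loop 20 0
    (.seq (.fill 21 7 (.const 0) removeExpr)
    (.seq closureProg
    (.ite (.read 7 (.reg 2)) (.fill 21 6 (.const 0) removeExpr) .skip)))

theorem ind_diff_above (S : Set (Fin n)) (x j : Fin n) :
    ind (S \ {a | x ∈ impClosure imps {a}}) j =
      ind S j * (1 - ind (impClosure imps {j}) x) := by
  classical
  rw [ind_val, ind_val, ind_val]
  by_cases h1 : j ∈ S <;> by_cases h2 : x ∈ impClosure imps {j} <;> simp [h1, h2]

theorem runs_removeFill (hN : Ample N imps) (hs : Ready imps s) {b : ℕ} (hb : 2 ≤ b) {x : Fin n}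
    {S : Set (Fin n)} (hx : s.reg 20 = x) (hS : Holds (s.mem 6) 0 S)
    (hQ : Q (s.fill 21 b 0 n (ind (S \ {a | x ∈ impClosure imps {a}})))) :
    Runs N (.fill 21 b (.const 0) removeExpr) s Q := by
  refine Runs.fillSet 0 (S \ {a | x ∈ impClosure imps {a}}) (by omega) hs.ground hN.ground
    (fun _ _ _ => rfl) ?_ hQ
  intro j s' hj hr hm hself
  have hs' : Ready imps s' :=
    hs.frame (r := 2) (b := 2) ⟨fun x hx => hr x (by omega), fun y hy => hm y (by omega)⟩
  have h6 : s'.mem 6 j = ind S j := by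
    by_cases h : 6 = b
    · subst h; rw [zero_add] at hself; rw [hself, hS.zero]
    · rw [hm 6 h, hS.zero]
  have h20 : s'.reg 20 = x := (hr 20 (by omega)).trans hx
  rw [ind_diff_above, removeExpr, Expr.eval_mul, Expr.eval_sub,
    hs'.eval_inClosure (a := .reg 21) (b := .reg 20) (x := j) (y := x) hj h20]
  simp [hj, h6]

theorem runs_minimizeProg (hN : Ample N imps) (hs : Ready imps s) {c : Fin n} {S : Set (Fin n)}
    (hc : s.reg 2 = c) (hS : Holds (s.mem 6) 0 S) (hd : IsDownSet (impClosure imps) S)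
    (hcS : c ∈ impClosure imps S) :
    Runs N minimizeProg s fun s' => Frame 20 6 s s' ∧ SameOut s s' ∧
      ∃ S' ⊆ S, IsMinDown (impClosure imps) c S' ∧ Holds (s'.mem 6) 0 S' := by
  refine Runs.loop' n 6 (fun x s' => ∃ S' ⊆ S, Holds (s'.mem 6) 0 S' ∧
    IsDownSet (impClosure imps) S' ∧ c ∈ impClosure imps S' ∧ ∀ y : Fin n, (y : ℕ) < x → y ∈ S' →
      c ∉ impClosure imps (S' \ {a | y ∈ impClosure imps {a}})) hs.ground (by omega)
    (by have := hN.ground; omega)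
    ⟨S, subset_rfl, hS, hd, hcS, fun y hy => absurd hy (Nat.not_lt_zero _)⟩ ?_ ?_
  · rintro x hx s₁ f₁ hx₁ ⟨S', hS', h6, hd', hc', hmin⟩
    have hs₁ := hs.frame f₁
    set U : Set (Fin n) := S' \ {a | (⟨x, hx⟩ : Fin n) ∈ impClosure imps {a}} with hU
    refine Runs.seq (runs_removeFill hN hs₁ (by omega) (x := ⟨x, hx⟩) hx₁ h6 ?_)
    set s₂ := s₁.fill 21 7 0 n (ind U)
    have f₂ : Frame 21 7 s₁ s₂ := State.fill_frame
    refine Runs.seq ((runs_closureProg hN (hs₁.frame f₂).toHasInput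
      (State.fill_holds U)).mono ?_)
    rintro s₃ ⟨f₃, o₃, h7⟩
    have f₁₃ : Frame 21 7 s₁ s₃ := f₂.trans f₃
    have hs₃ := hs₁.frame f₁₃
    have o₁₃ : SameOut s₁ s₃ := State.fill_sameOut.trans o₃
    have h6₃ : Holds (s₃.mem 6) 0 S' := by rw [f₁₃.2 6 (by omega)]; exact h6
    have hx₃ : s₃.reg 20 = x := (f₁₃.1 20 (by omega)).trans hx₁
    have hc₃ : s₃.reg 2 = c := ((f₁.trans f₁₃).1 2 (by omega)).trans hc
    have htest : (Expr.read 7 (.reg 2)).eval s₃ = ind (impClosure imps U) c := by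
      simp [hc₃, h7.zero]
    refine Runs.ite (fun ht => ?_) (fun ht => ?_)
    · rw [htest, ind_ne_zero] at ht
      refine runs_removeFill hN hs₃ (by omega) (x := ⟨x, hx⟩) hx₃ h6₃
        ⟨f₁₃.mono.then_fill, o₁₃.trans State.fill_sameOut, U,
          (Set.sdiff_subset).trans hS', by rw [State.set_mem]; exact State.fill_holds U, hd'.diff _, ht, ?_⟩
      intro y hy hyU hcon
      rcases Nat.lt_succ_iff_lt_or_eq.1 hy with h | h
      · exact hmin y h hyU.1 ((impClosure imps).monotone
          (Set.sdiff_subset_sdiff_left Set.sdiff_subset) hcon)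
      · obtain rfl : y = ⟨x, hx⟩ := Fin.ext h
        exact hyU.2 (mem_closure_self _)
    · rw [htest, ind_eq_zero] at ht
      refine Runs.skip ⟨f₁₃.mono, o₁₃, S', hS', h6₃, hd', hc', fun y hy hyS => ?_⟩
      rcases Nat.lt_succ_iff_lt_or_eq.1 hy with h | h
      · exact hmin y h hyS
      · obtain rfl : y = ⟨x, hx⟩ := Fin.ext h
        exact ht
  · rintro s' f o ⟨S', hS', h6, hd', hc', hmin⟩
    exact ⟨f, o, S', hS', isMinDown_of_forall_diff hd' hc' fun x hx => hmin x x.2 hx, h6⟩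

/-! ### The queue -/

/-- The queue contains the sets of `L`: they are in the slots of bank `4`, their number is in bank
`2`, and they are marked by `c + 1` in bank `3`. -/
structure IsQueue (imps : List (Implication (Fin n))) (c : Fin n) (s : State)
    (L : List (Set (Fin n))) : Prop where
  length : s.mem 2 0 = L.length
  nodup : L.Nodup
  isMinDown : ∀ S ∈ L, IsMinDown (impClosure imps) c S
  slot : ∀ i (h : i < L.length), Holds (s.mem 4) (i * n) L[i]
  mark : ∀ S : Set (Fin n), s.mem 3 (mask S n) = c + 1 ↔ S ∈ L
  mark_le : ∀ a, s.mem 3 a ≤ c + 1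

theorem IsQueue.congr {c : Fin n} {s' : State} {L : List (Set (Fin n))} (h : IsQueue imps c s L)
    (h2 : s'.mem 2 = s.mem 2) (h3 : s'.mem 3 = s.mem 3) (h4 : s'.mem 4 = s.mem 4) :
    IsQueue imps c s' L :=
  ⟨by rw [h2, h.length], h.nodup, h.isMinDown, by rw [h4]; exact h.slot, by rw [h3]; exact h.mark,
    by rw [h3]; exact h.mark_le⟩

theorem IsQueue.frame {c : Fin n} {s' : State} {L : List (Set (Fin n))} {r b : ℕ}
    (h : IsQueue imps c s L) (f : Frame r b s s') (hb : 5 ≤ b := by omega) :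
    IsQueue imps c s' L := h.congr (f.2 2 (by omega)) (f.2 3 (by omega)) (f.2 4 (by omega))

theorem length_le_of_nodup {L : List (Set (Fin n))} (h : L.Nodup) : L.length ≤ 2 ^ n := by
  classical
  have := h.length_le_card
  rwa [Fintype.card_set, Fintype.card_fin] at this

theorem Ample.two_pow_lt (hN : Ample N imps) : 2 ^ n < 2 ^ N :=
  Nat.pow_lt_pow_right (by norm_num) hN.ground

/-- Compute the mask of the set in bank `6` in register `22`. -/
def maskProg : Prog :=
  .seq (.assign 22 (.const 0))
    (.loop 21 0 (.assign 22 (.add (.add (.reg 22) (.reg 22)) (.read 6 (.reg 21)))))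

theorem runs_maskProg (hN : Ample N imps) (hn : s.reg 0 = n) {S : Set (Fin n)}
    (hS : Holds (s.mem 6) 0 S) :
    Runs N maskProg s fun s' => Frame 20 7 s s' ∧ SameOut s s' ∧ s'.reg 22 = mask S n := by
  refine Runs.seq (Runs.assign (by simp) (Runs.loop' n 7 (fun j s' => s'.reg 22 = mask S j)
    (by simp [State.set_reg, hn]) (by omega) (by have := hN.ground; omega)
    (by simp [State.set_reg, mask]) ?_ ?_))
  · intro j hj s' f hj' h22
    have h6 : s'.mem 6 j = ind S j := by
      rw [f.2 6 (by omega)]; exact hS.zero ⟨j, hj⟩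
    have hval : (Expr.add (.add (.reg 22) (.reg 22)) (.read 6 (.reg 21))).eval s' =
        mask S (j + 1) := by simp [h22, hj', h6, mask]
    refine Runs.assign ?_ ⟨Frame.set, ⟨rfl, rfl⟩, ?_⟩
    · rw [hval]
      exact (mask_lt S _).trans_le (Nat.pow_le_pow_right (by norm_num) (by have := hN.ground; omega))
    · rw [hval]; simp [State.set_reg]
  · intro s' f o h
    exact ⟨(Frame.set (b := 7)).trans f, SameOut.trans ⟨rfl, rfl⟩ o, h⟩

/-- Append the set in bank `6`, with mask in register `22`, to the queue, unless it is marked. -/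
def enqueueProg : Prog :=
  .ite (.sub (.read 3 (.reg 22)) (.reg 2)) .skip
    (.seq (.write 3 (.reg 22) (.add (.reg 2) (.const 1)))
    (.seq (.fill 21 4 (.mul (.read 2 (.const 0)) (.reg 0)) (.read 6 (.reg 21)))
      (.write 2 (.const 0) (.add (.read 2 (.const 0)) (.const 1)))))

theorem runs_enqueueProg (hN : Ample N imps) (hs : Ready imps s) {c : Fin n} {S : Set (Fin n)}
    {L : List (Set (Fin n))} (hc : s.reg 2 = c) (hS : Holds (s.mem 6) 0 S)
    (hmask : s.reg 22 = mask S n) (hL : IsQueue imps c s L)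
    (hmin : IsMinDown (impClosure imps) c S) :
    Runs N enqueueProg s fun s' => Frame 20 2 s s' ∧ SameOut s s' ∧
      ((S ∈ L ∧ IsQueue imps c s' L) ∨ (S ∉ L ∧ IsQueue imps c s' (L ++ [S]))) := by
  have hiff : (Expr.sub (.read 3 (.reg 22)) (.reg 2)).eval s ≠ 0 ↔ S ∈ L := by
    have := hL.mark_le (mask S n)
    rw [← hL.mark S]
    simp only [Expr.eval_sub, Expr.eval_read, Expr.eval_reg, hmask, hc]
    omega
  refine Runs.ite (fun h => Runs.skip ⟨.rfl, .rfl, Or.inl ⟨hiff.1 h, hL⟩⟩) (fun h => ?_)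
  have hSL : S ∉ L := fun h' => hiff.2 h' h
  have hnd : (L ++ [S]).Nodup := by
    rw [List.nodup_append]
    exact ⟨hL.nodup, by simp, by rintro a ha b hb rfl; simp at hb; exact hSL (hb ▸ ha)⟩
  have hlen := length_le_of_nodup hnd
  rw [List.length_append, List.length_singleton] at hlen
  refine Runs.seq (Runs.write ?_ ?_)
  · simp only [Expr.eval_add, Expr.eval_reg, hc, Expr.eval_const]
    exact lt_two_pow_of_le (by have := hN.ground; omega)
  simp only [Expr.eval_add, Expr.eval_reg, hc, Expr.eval_const, hmask]
  set s₁ := s.store 3 (mask S n) (c + 1)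
  have f₁ : Frame 20 3 s s₁ := Frame.store
  have hs₁ := hs.frame f₁
  have h2 : s₁.mem 2 = s.mem 2 := f₁.2 2 (by omega)
  have h6 : s₁.mem 6 = s.mem 6 := State.store_mem_of_ne (by omega)
  have h4 : s₁.mem 4 = s.mem 4 := State.store_mem_of_ne (by omega)
  refine Runs.seq (Runs.fillSet (L.length * n) S (by omega) hs₁.ground hN.ground ?_ ?_ ?_)
  · intro s' hr hm
    simp [hm 2 (by omega), hr 0 (by omega), hs₁.ground, h2, hL.length]
  · intro j s' hj hr hm _
    simp [hm 6 (by omega), hj, h6, hS.zero]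
  set s₂ := s₁.fill 21 4 (L.length * n) n (ind S)
  have f₂ : Frame 20 2 s s₂ := f₁.mono.then_fill
  have h2' : s₂.mem 2 = s.mem 2 := (State.fill_mem_of_ne (by omega)).trans h2
  have h3' : s₂.mem 3 = s₁.mem 3 := State.fill_mem_of_ne (by omega)
  have hval : (Expr.add (.read 2 (.const 0)) (.const 1)).eval s₂ = L.length + 1 := by
    simp [h2', hL.length]
  refine Runs.write ?_ ⟨f₂.then_store, ⟨rfl, rfl⟩, Or.inr ⟨hSL, ?_, hnd, ?_, ?_, ?_, ?_⟩⟩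
  · rw [hval]; exact hlen.trans_lt hN.two_pow_lt
  · rw [hval]; simp [State.store_mem]
  · intro T hT
    rcases List.mem_append.1 hT with hT | hT
    · exact hL.isMinDown T hT
    · rw [List.mem_singleton.1 hT]; exact hmin
  · rw [State.store_mem_of_ne (by omega)]
    intro i hi
    rw [List.length_append, List.length_singleton] at hi
    rcases Nat.lt_succ_iff_lt_or_eq.1 hi with hi | rfl
    · rw [List.getElem_append_left hi]
      exact State.fill_holds_of_disjoint (h4 ▸ hL.slot i hi) (slot_disjoint n (by omega))
    · rw [List.getElem_append_right le_rfl]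
      simp only [Nat.sub_self, List.getElem_cons_zero]
      exact State.fill_holds S
  · intro T
    rw [State.store_mem_of_ne (by omega), h3', State.store_mem, if_pos rfl, Function.update_apply,
      List.mem_append, List.mem_singleton, ← hL.mark T]
    split_ifs with hT
    · simp [mask_injective hT]
    · have : T ≠ S := fun e => hT (by rw [e])
      simp [this]
  · intro a
    rw [State.store_mem_of_ne (by omega), h3', State.store_mem, if_pos rfl, Function.update_apply]
    split_ifs
    · exact le_rfl
    · exact hL.mark_le a

/-- Minimize the down-set in bank `6` and append the result to the queue, unless it is marked. -/
def pushProg : Prog := .seq minimizeProg (.seq maskProg enqueueProg)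

theorem runs_pushProg (hN : Ample N imps) (hs : Ready imps s) {c : Fin n} {S : Set (Fin n)}
    {L : List (Set (Fin n))} (hc : s.reg 2 = c) (hL : IsQueue imps c s L)
    (hS : Holds (s.mem 6) 0 S) (hd : IsDownSet (impClosure imps) S)
    (hcS : c ∈ impClosure imps S) :
    Runs N pushProg s fun s' => Frame 20 2 s s' ∧ SameOut s s' ∧
      ∃ S' ⊆ S, IsMinDown (impClosure imps) c S' ∧
        ((S' ∈ L ∧ IsQueue imps c s' L) ∨ (S' ∉ L ∧ IsQueue imps c s' (L ++ [S']))) := by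
  refine Runs.seq ((runs_minimizeProg hN hs hc hS hd hcS).mono ?_)
  rintro s₁ ⟨f₁, o₁, S', hS', hmin, h6⟩
  refine Runs.seq ((runs_maskProg hN (hs.frame f₁).ground h6).mono ?_)
  rintro s₂ ⟨f₂, o₂, h22⟩
  have f₁₂ := f₁.trans f₂
  refine (runs_enqueueProg hN (hs.frame f₁₂) ((f₁₂.1 2 (by omega)).trans hc)
    (by rw [f₂.2 6 (by omega)]; exact h6) h22 (hL.frame f₁₂) hmin).mono ?_
  rintro s₃ ⟨f₃, o₃, h⟩
  exact ⟨f₁₂.mono.trans f₃, (o₁.trans o₂).trans o₃, S', hS', hmin, h⟩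

/-! ### Neighbors -/

/-- Write the neighbor, for the implication at the position in register `11`, of the set in slot
`reg 3` of the queue into bank `6`. -/
def neighborProg : Prog :=
  .seq (.fill 12 5 (.const 0) (.mul (.read 4 (.add (.mul (.reg 3) (.reg 0)) (.reg 12)))
    (.sub (.const 1) (.inClosure (.read 0 (.reg 11)) (.reg 12)))))
  (.seq (.assign 12 (.read 0 (.add (.reg 11) (.const 1))))
  (.seq (.loop 13 12
    (.write 5 (.read 0 (.add (.add (.reg 11) (.const 2)) (.reg 13))) (.const 1)))
  (.seq (.fill 12 6 (.const 0) (.const 0))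
  (.loop 13 0 (.fill 14 6 (.const 0) (.sub (.const 1) (.sub (.const 1)
    (.add (.read 6 (.reg 14)) (.mul (.read 5 (.reg 13)) (.inClosure (.reg 13) (.reg 14)))))))))))

theorem runs_neighborProg (hN : Ample N imps) (hs : Ready imps s) {j h : ℕ} (hj : j < imps.length)
    (hp : s.reg 11 = impPos imps j) (hh : s.reg 3 = h) {S : Set (Fin n)}
    (hS : Holds (s.mem 4) (h * n) S) :
    Runs N neighborProg s fun s' => Frame 12 5 s s' ∧ SameOut s s' ∧
      Holds (s'.mem 6) 0 (neighbor imps imps[j] S) := by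
  classical
  have hn1 := hN.ground
  have hcN : imps[j].prem.card ≤ N := hN.card.trans (by omega)
  set K₀ : Set (Fin n) := S \ impClosure imps {imps[j].concl} with hK₀
  refine Runs.seq (Runs.fillSet 0 K₀ (by omega) hs.ground hN.ground (fun _ _ _ => rfl) ?_ ?_)
  · intro i s' hi hr hm _
    have f : Frame 12 5 s s' := ⟨fun x hx => hr x (by omega), fun y hy => hm y (by omega)⟩
    have hs' := hs.frame f
    rw [Expr.eval_mul, Expr.eval_sub,
      hs'.eval_inClosure (a := .read 0 (.reg 11)) (b := .reg 12) (x := imps[j].concl) (y := i)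
        (by simp [hm 0 (by omega), hr 11 (by omega), hp, hs.input.concl j hj]) hi]
    simp only [Expr.eval_read, Expr.eval_add, Expr.eval_mul, Expr.eval_reg, Expr.eval_const,
      hm 4 (by omega), hr 3 (by omega), hs'.ground, hh, hi, hS i]
    rw [ind_val, ind_val, ind_val]
    by_cases h1 : i ∈ S <;> by_cases h2 : i ∈ impClosure imps {imps[j].concl} <;>
      simp [hK₀, h1, h2]
  set s₁ := s.fill 12 5 0 n (ind K₀)
  have f₁ : Frame 12 5 s s₁ := State.fill_frame
  have hs₁ := hs.frame f₁
  have hp₁ : s₁.reg 11 = impPos imps j := (f₁.1 11 (by omega)).trans hp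
  have hval : (Expr.read 0 (.add (.reg 11) (.const 1))).eval s₁ = imps[j].prem.card := by
    simp [hp₁, hs₁.input.card j hj]
  refine Runs.seq (Runs.assign (by rw [hval]; exact lt_two_pow_of_le hcN) ?_)
  rw [hval]
  set s₂ := s₁.set 12 imps[j].prem.card with hs₂_def
  have f₂ : Frame 12 5 s s₂ := f₁.then_set
  have hK : Holds (s₂.mem 5) 0 K₀ := by
    rw [hs₂_def, State.set_mem]; exact State.fill_holds K₀
  refine Runs.seq (Runs.loop' imps[j].prem.card 5 (fun i s' => Holds (s'.mem 5) 0
    (K₀ ∪ {a | ∃ i' < i, s.mem 0 (impPos imps j + 2 + i') = a})) (by simp [hs₂_def]) (by omega) hcN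
    (by simpa using hK) ?_ ?_)
  · intro i hi s' f' hi' hK'
    have f := f₂.trans f'
    obtain ⟨a, ha, e⟩ := hs.input.prem j hj i hi
    have hval : (Expr.read 0 (.add (.add (.reg 11) (.const 2)) (.reg 13))).eval s' = a := by
      simp [f.2 0 (by omega), f.1 11 (by omega), hp, hi', e]
    refine Runs.write (by simpa using hN.one_lt) ⟨Frame.store, ⟨rfl, rfl⟩, ?_⟩
    have hset : K₀ ∪ {a | ∃ i' < i + 1, s.mem 0 (impPos imps j + 2 + i') = a} =
        insert a (K₀ ∪ {a | ∃ i' < i, s.mem 0 (impPos imps j + 2 + i') = a}) := by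
      ext b
      constructor
      · rintro (h | ⟨i', hi', e'⟩)
        · exact Or.inr (Or.inl h)
        · rcases Nat.lt_succ_iff_lt_or_eq.1 hi' with h | rfl
          · exact Or.inr (Or.inr ⟨i', h, e'⟩)
          · exact Or.inl (Fin.ext (e'.symm.trans e))
      · rintro (rfl | h | ⟨i', hi', e'⟩)
        · exact Or.inr ⟨i, by omega, e⟩
        · exact Or.inl h
        · exact Or.inr ⟨i', by omega, e'⟩
    rw [hval, State.set_mem, State.store_mem, if_pos rfl, hset]
    exact hK'.update_one a
  intro s₃ f₃' o₃ hK₃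
  have f₃ := f₂.trans f₃'
  have hs₃ := hs.frame f₃
  set K : Set (Fin n) := K₀ ∪ imps[j].prem with hK_def
  have hKeq : K₀ ∪ {a | ∃ i' < imps[j].prem.card, s.mem 0 (impPos imps j + 2 + i') = a} = K := by
    rw [hK_def]
    congr 1
    ext a
    constructor
    · rintro ⟨i, hi, e⟩
      obtain ⟨b, hb, e'⟩ := hs.input.prem j hj i hi
      obtain rfl : a = b := Fin.ext (e.symm.trans e')
      exact hb
    · intro ha
      exact hs.input.exists_of_mem_prem j hj a ha
  rw [hKeq] at hK₃
  refine Runs.seq (Runs.fillSet 0 (∅ : Set (Fin n)) (by omega) hs₃.ground hN.ground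
    (fun _ _ _ => rfl) (fun i _ _ _ _ _ => by rw [ind_of_notMem (by simp)]; rfl) ?_)
  set s₄ := s₃.fill 12 6 0 n (ind (∅ : Set (Fin n)))
  have f₄ : Frame 12 5 s s₄ := f₃.then_fill
  have hs₄ := hs.frame f₄
  have hK₄ : Holds (s₄.mem 5) 0 K := by
    rw [State.fill_mem_of_ne (by omega)]; exact hK₃
  have hJ₄ : Holds (s₄.mem 6) 0 (∅ : Set (Fin n)) := State.fill_holds _
  refine Runs.loop' n 6 (fun i s' => Holds (s'.mem 6) 0
    (⋃ a ∈ {a ∈ K | (a : ℕ) < i}, impClosure imps {a})) hs₄.ground (by omega) (by omega)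
    (by simpa using hJ₄) ?_ ?_
  · intro i hi s₅ f₅ hi₅ hJ
    have hs₅ := hs₄.frame f₅
    have hK₅ : Holds (s₅.mem 5) 0 K := by rw [f₅.2 5 (by omega)]; exact hK₄
    refine Runs.fillSet 0 (⋃ a ∈ {a ∈ K | (a : ℕ) < i + 1}, impClosure imps {a}) (by omega)
      hs₅.ground hN.ground (fun _ _ _ => rfl) ?_
      ⟨State.fill_frame, State.fill_sameOut, by rw [State.set_mem]; exact State.fill_holds _⟩
    intro b s' hb hr hm hself
    have hs' := hs₅.frame (r := 2) (b := 2)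
      ⟨fun x hx => hr x (by omega), fun y hy => hm y (by omega)⟩
    have e13 : s'.reg 13 = i := (hr 13 (by omega)).trans hi₅
    have e5 : s'.mem 5 i = ind K i := by rw [hm 5 (by omega)]; exact hK₅.zero ⟨i, hi⟩
    have e6 : s'.mem 6 b = ind (⋃ a ∈ {a ∈ K | (a : ℕ) < i}, impClosure imps {a}) b := by
      rw [zero_add] at hself; rw [hself, hJ.zero]
    rw [Expr.eval_sub, Expr.eval_sub, Expr.eval_add, Expr.eval_mul,
      hs'.eval_inClosure (a := .reg 13) (b := .reg 14) (x := ⟨i, hi⟩) (y := b) e13 hb]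
    simp only [Expr.eval_const, Expr.eval_read, Expr.eval_reg, hb, e13, e5, e6]
    have hstep : b ∈ (⋃ a ∈ {a ∈ K | (a : ℕ) < i + 1}, impClosure imps {a}) ↔
        b ∈ (⋃ a ∈ {a ∈ K | (a : ℕ) < i}, impClosure imps {a}) ∨
          (⟨i, hi⟩ ∈ K ∧ b ∈ impClosure imps {⟨i, hi⟩}) := by
      simp only [Set.mem_iUnion, Set.mem_ofPred_eq, exists_prop]
      constructor
      · rintro ⟨a, ⟨ha, hai⟩, hba⟩
        rcases Nat.lt_succ_iff_lt_or_eq.1 hai with h | h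
        · exact Or.inl ⟨a, ⟨ha, h⟩, hba⟩
        · obtain rfl : a = ⟨i, hi⟩ := Fin.ext h
          exact Or.inr ⟨ha, hba⟩
      · rintro (⟨a, ⟨ha, hai⟩, hba⟩ | ⟨ha, hba⟩)
        · exact ⟨a, ⟨ha, by omega⟩, hba⟩
        · exact ⟨_, ⟨ha, by simp⟩, hba⟩
    have hiK : ind K i = if (⟨i, hi⟩ : Fin n) ∈ K then 1 else 0 := ind_val K ⟨i, hi⟩
    rw [hiK, ind_val, ind_val, ind_val, if_congr hstep rfl rfl]
    by_cases h1 : b ∈ (⋃ a ∈ {a ∈ K | (a : ℕ) < i}, impClosure imps {a}) <;>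
      by_cases h2 : (⟨i, hi⟩ : Fin n) ∈ K <;>
        by_cases h3 : b ∈ impClosure imps {(⟨i, hi⟩ : Fin n)} <;> simp only [h1, h2, h3] <;> simp
  · intro s' f o hJ
    refine ⟨f₄.trans f, (o₃.trans ⟨rfl, rfl⟩ : SameOut s s₄).trans o, ?_⟩
    convert hJ using 1
    ext b
    simp [neighbor, binClosure, hK_def, hK₀]

/-- Push all neighbors of the set in slot `reg 3` of the queue. -/
def expandProg : Prog := .scan 10 (.seq neighborProg pushProg)

theorem runs_expandProg (hN : Ample N imps) (hs : Ready imps s) {c : Fin n} {h : ℕ}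
    {L : List (Set (Fin n))} (hc : s.reg 2 = c) (hh : s.reg 3 = h) (hL : IsQueue imps c s L)
    (hlt : h < L.length) :
    Runs N expandProg s fun s' => Frame 10 2 s s' ∧ SameOut s s' ∧
      ∃ L', L <+: L' ∧ IsQueue imps c s' L' ∧
        ∀ I ∈ imps, ∃ S' ∈ L', S' ⊆ neighbor imps I L[h] := by
  refine Runs.scan 2 (fun j s' => ∃ L', L <+: L' ∧ IsQueue imps c s' L' ∧
    ∀ j' < j, ∀ hj : j' < imps.length, ∃ S' ∈ L', S' ⊆ neighbor imps imps[j'] L[h]) hN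
    hs.toHasInput (by omega) (by omega) ?_ ⟨L, List.prefix_rfl, hL, fun _ h => absurd h (by omega)⟩
    ?_ ?_
  · rintro j s x v - ⟨L', hp, hL', h'⟩
    exact ⟨L', hp, hL'.congr rfl rfl rfl, h'⟩
  · rintro j hj s₁ f₁ - hp ⟨L', hpre, hL', hnb⟩
    have hs₁ := hs.frame f₁
    have hlt' : h < L'.length := hlt.trans_le hpre.length_le
    have hslot := hL'.slot h hlt'
    rw [← hpre.getElem hlt] at hslot
    refine Runs.seq ((runs_neighborProg hN hs₁ hj hp ((f₁.1 3 (by omega)).trans hh) hslot).mono ?_)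
    rintro s₂ ⟨f₂, o₂, h6⟩
    refine (runs_pushProg hN (hs₁.frame f₂) (((f₁.trans f₂ (hb := by omega)).1 2 (by omega)).trans hc)
      (hL'.frame f₂) h6 (isDownSet_binClosure _)
      (mem_closure_neighbor (List.getElem_mem hj)
        (hL.isMinDown _ (List.getElem_mem hlt)).2.1)).mono ?_
    rintro s₃ ⟨f₃, o₃, S', hS', -, hcase⟩
    refine ⟨f₂.mono.trans f₃, o₂.trans o₃, ?_⟩
    have ext : ∀ L'', L' <+: L'' → S' ∈ L'' → ∀ j' < j + 1, ∀ hj : j' < imps.length,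
        ∃ S' ∈ L'', S' ⊆ neighbor imps imps[j'] L[h] := by
      intro L'' hpre' hmem j' hj' hlt''
      rcases Nat.lt_succ_iff_lt_or_eq.1 hj' with h' | rfl
      · obtain ⟨T, hT, hsub⟩ := hnb j' h' hlt''
        exact ⟨T, hpre'.subset hT, hsub⟩
      · exact ⟨S', hmem, hS'⟩
    rcases hcase with ⟨hm, hq⟩ | ⟨hm, hq⟩
    · exact ⟨L', hpre, hq, ext L' List.prefix_rfl hm⟩
    · exact ⟨L' ++ [S'], hpre.trans (List.prefix_append _ _), hq,
        ext _ (List.prefix_append _ _) (by simp)⟩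
  · rintro s' f o ⟨L', hpre, hL', hnb⟩
    refine ⟨f, o, L', hpre, hL', fun I hI => ?_⟩
    obtain ⟨j, hj, rfl⟩ := List.mem_iff_getElem.1 hI
    exact hnb j hj hj

end RAM

section Encoding

variable {n : ℕ}

theorem encodeImplication_injective :
    Function.Injective (encodeImplication : Implication (Fin n) → List ℕ) := by
  rintro ⟨A, c⟩ ⟨B, d⟩ h
  simp only [encodeImplication, List.cons.injEq] at h
  obtain ⟨h1, -, h2⟩ := h
  have h3 := List.map_injective_iff.2 Fin.val_injective h2
  have h4 : A = B := by rw [← A.sort_toFinset (r := (· ≤ ·)), h3, Finset.sort_toFinset]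
  rw [h4, Fin.ext h1]

theorem sort_map_val (A : Finset (Fin n)) :
    A.sort.map Fin.val = (List.range n).filter fun j => ind (A : Set (Fin n)) j ≠ 0 := by
  have h1 : (A.sort.map Fin.val).Pairwise (· < ·) := by
    rw [List.pairwise_map]
    exact A.sortedLT_sort.pairwise
  have h2 : ((List.range n).filter fun j => ind (A : Set (Fin n)) j ≠ 0).Pairwise (· < ·) :=
    List.pairwise_lt_range.filter _
  refine h1.eq_of_mem_iff h2 fun j => ?_
  simp only [List.mem_map, Finset.mem_sort, List.mem_filter, List.mem_range, decide_eq_true_eq]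
  constructor
  · rintro ⟨a, ha, rfl⟩
    exact ⟨a.2, ind_ne_zero.2 ha⟩
  · rintro ⟨hj, h⟩
    exact ⟨⟨j, hj⟩, (ind_ne_zero (i := ⟨j, hj⟩)).1 h, rfl⟩

end Encoding

namespace RAM

variable {n N : ℕ} {imps : List (Implication (Fin n))} {s : State} {Q : State → Prop}

/-- The implications of `S` have been output, each of them once. -/
structure HasOutput (s : State) (S : Set (Implication (Fin n))) : Prop where
  word : s.word = []
  nodup : s.done.Nodup
  mem : ∀ w, w ∈ s.done ↔ w ∈ encodeImplication '' S

theorem HasOutput.insert {S : Set (Implication (Fin n))} {s' : State} (h : HasOutput s S)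
    {I : Implication (Fin n)} (hI : I ∉ S) (hw : s'.word = [])
    (hd : s'.done = s.done ++ [encodeImplication I]) : HasOutput s' (insert I S) := by
  refine ⟨hw, ?_, fun w => ?_⟩
  · rw [hd, List.nodup_append]
    refine ⟨h.nodup, by simp, ?_⟩
    rintro a ha b hb rfl
    rw [List.mem_singleton.1 hb, h.mem] at ha
    obtain ⟨J, hJ, e⟩ := ha
    exact hI (encodeImplication_injective e ▸ hJ)
  · rw [hd, List.mem_append, h.mem, List.mem_singleton, Set.image_insert_eq, Set.mem_insert_iff,
      or_comm]

theorem HasOutput.sameOut {S : Set (Implication (Fin n))} {s' : State} (h : HasOutput s S)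
    (o : SameOut s s') : HasOutput s' S :=
  ⟨o.1.trans h.word, o.2 ▸ h.nodup, o.2 ▸ h.mem⟩

/-! ### Initialization -/

/-- Load the size of the input and compute the closures of the elements. -/
def initProg : Prog :=
  .seq (.assign 0 (.read 0 (.const 0)))
  (.seq (.assign 1 (.read 0 (.const 1)))
  (.loop 10 0
    (.seq (.fill 11 7 (.const 0) (.const 0))
    (.seq (.write 7 (.reg 10) (.const 1))
    (.seq closureProg
    (.fill 11 1 (.mul (.reg 10) (.reg 0)) (.read 7 (.reg 11))))))))

theorem runs_initProg (hN : Ample N imps) (hin : IsInput (s.mem 0) imps) :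
    Runs N initProg s fun s' => Ready imps s' ∧ SameOut s s' ∧ s'.mem 3 = s.mem 3 := by
  have hn1 := hN.ground
  have e0 : (Expr.read 0 (.const 0)).eval s = n := by simp [hin.ground]
  refine Runs.seq (Runs.assign (by rw [e0]; exact lt_two_pow_of_le (by omega)) ?_)
  rw [e0]
  have e1 : (Expr.read 0 (.const 1)).eval (s.set 0 n) = imps.length := by simp [hin.count]
  refine Runs.seq (Runs.assign (by rw [e1]; exact lt_two_pow_of_le hN.count) ?_)
  rw [e1]
  set s₁ := (s.set 0 n).set 1 imps.length with hs₁_def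
  have hs₁ : HasInput imps s₁ := ⟨by simp [s₁, State.set_reg], by simp [s₁], hin⟩
  have hm₁ : s₁.mem = s.mem := rfl
  refine Runs.loop' n 1 (fun i s' => s'.mem 3 = s.mem 3 ∧
    ∀ a : Fin n, (a : ℕ) < i → Holds (s'.mem 1) (a * n) (impClosure imps {a})) hs₁.ground (by omega)
    (by omega) ⟨rfl, fun a ha => absurd ha (Nat.not_lt_zero _)⟩ ?_ ?_
  · rintro i hi s₂ f₂ hi₂ ⟨h3, h1⟩
    have hs₂ := hs₁.frame f₂
    refine Runs.seq (Runs.fillSet 0 (∅ : Set (Fin n)) (by omega) hs₂.ground hN.ground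
      (fun _ _ _ => rfl) (fun i _ _ _ _ _ => by rw [ind_of_notMem (by simp)]; rfl) ?_)
    set s₃ := s₂.fill 11 7 0 n (ind (∅ : Set (Fin n)))
    have f₃ : Frame 11 7 s₂ s₃ := State.fill_frame
    have hi₃ : s₃.reg 10 = i := (f₃.1 10 (by omega)).trans hi₂
    refine Runs.seq (Runs.write (by simpa using hN.one_lt) ?_)
    simp only [Expr.eval_reg, Expr.eval_const, hi₃]
    set s₄ := s₃.store 7 i 1
    have f₄ : Frame 11 7 s₂ s₄ := f₃.then_store
    have h7 : Holds (s₄.mem 7) 0 ({⟨i, hi⟩} : Set (Fin n)) := by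
      have h7 : Holds (s₃.mem 7) 0 (∅ : Set (Fin n)) := State.fill_holds _
      have := h7.update_one ⟨i, hi⟩
      rw [insert_empty_eq] at this
      rw [State.store_mem, if_pos rfl]; exact this
    refine Runs.seq ((runs_closureProg hN (hs₂.frame f₄) h7).mono ?_)
    rintro s₅ ⟨f₅', o₅, h7⟩
    have f₅ : Frame 11 7 s₂ s₅ := f₄.trans f₅'
    have hs₅ := hs₂.frame f₅
    have hi₅ : s₅.reg 10 = i := (f₅.1 10 (by omega)).trans hi₂
    refine Runs.fillSet (i * n) (impClosure imps {(⟨i, hi⟩ : Fin n)}) (by omega) hs₅.ground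
      hN.ground (fun s' hr _ => by simp [hr 10 (by omega), hr 0 (by omega), hi₅, hs₅.ground]) ?_
      ⟨f₅.mono.then_fill, (SameOut.trans ⟨rfl, rfl⟩ o₅ : SameOut s₂ s₅).trans State.fill_sameOut,
        ?_, ?_⟩
    · intro j s' hj hr hm _
      simp [hj, hm 7 (by omega), h7.zero]
    · rw [State.set_mem, State.fill_mem_of_ne (by omega), f₅.2 3 (by omega), h3]
    · intro a ha
      rw [State.set_mem]
      rcases Nat.lt_succ_iff_lt_or_eq.1 ha with h | h
      · refine State.fill_holds_of_disjoint ?_ (slot_disjoint n (by omega))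
        rw [f₅.2 1 (by omega)]
        exact h1 a h
      · obtain rfl : a = ⟨i, hi⟩ := Fin.ext h
        exact State.fill_holds _
  · rintro s' f o ⟨h3, h1⟩
    exact ⟨⟨hs₁.frame f, fun a => h1 a a.2⟩, SameOut.trans ⟨rfl, rfl⟩ o, h3⟩

/-! ### Output -/

/-- Is zero if and only if the two expressions have the same value. -/
def Expr.dist (a b : Expr) : Expr := .add (.sub a b) (.sub b a)

theorem Expr.eval_dist_ne_zero {a b : Expr} : (Expr.dist a b).eval s ≠ 0 ↔ a.eval s ≠ b.eval s := by
  simp only [dist, eval_add, eval_sub]; omega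

/-- Output the binary implications with conclusion `reg 2`. -/
def binaryProg : Prog :=
  .loop 10 0
    (.ite (.mul (.inClosure (.reg 10) (.reg 2)) (.dist (.reg 10) (.reg 2)))
      (.seq (.put (.reg 2)) (.seq (.put (.const 1)) (.seq (.put (.reg 10)) .emit))) .skip)

/-- The binary implications with conclusion `c` and premise less than `j`. -/
def binaryBelow (imps : List (Implication (Fin n))) (c : Fin n) (j : ℕ) :
    Set (Implication (Fin n)) :=
  {I | I.concl = c ∧ ∃ a : Fin n, (a : ℕ) < j ∧ I.prem = {a} ∧ c ∈ impClosure imps {a} \ {a}}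

theorem runs_binaryProg (hN : Ample N imps) (hs : Ready imps s) {c : Fin n} (hc : s.reg 2 = c)
    {S : Set (Implication (Fin n))} (hS : ∀ I ∈ S, I.concl ≠ c) (hout : HasOutput s S) :
    Runs N binaryProg s fun s' => Frame 10 8 s s' ∧ HasOutput s' (S ∪ binaryBelow imps c n) := by
  refine Runs.loop n 8 (fun j s' => HasOutput s' (S ∪ binaryBelow imps c j)) hs.ground (by omega)
    (by have := hN.ground; omega) ?_ ?_ (fun s' f _ h => ⟨f, h⟩)
  · have : binaryBelow imps c 0 = ∅ := by
      ext I; simp [binaryBelow]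
    rw [this, Set.union_empty]
    exact hout.sameOut ⟨rfl, rfl⟩
  · intro j hj s₁ f₁ hj₁ hout₁
    have hs₁ := hs.frame f₁
    have hc₁ : s₁.reg 2 = c := (f₁.1 2 (by omega)).trans hc
    set a : Fin n := ⟨j, hj⟩ with ha
    have hiff : (Expr.mul (.inClosure (.reg 10) (.reg 2)) (.dist (.reg 10) (.reg 2))).eval s₁ ≠ 0 ↔
        c ∈ impClosure imps {a} \ {a} := by
      rw [Expr.eval_mul, Nat.mul_ne_zero_iff, Expr.eval_dist_ne_zero,
        hs₁.eval_inClosure (a := .reg 10) (b := .reg 2) (x := a) (y := c) hj₁ hc₁, ind_ne_zero,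
        Expr.eval_reg, Expr.eval_reg, hj₁, hc₁, Set.mem_sdiff, Set.mem_singleton_iff, Fin.ext_iff,
        ne_comm (a := j)]
    refine Runs.ite (fun h => ?_) (fun h => ?_)
    · have hmem := hiff.1 h
      refine Runs.seq (Runs.put (Runs.seq (Runs.put (Runs.seq (Runs.put (Runs.emit ?_))))))
      refine ⟨⟨fun _ _ => rfl, fun _ _ => rfl⟩, ?_⟩
      have hset : S ∪ binaryBelow imps c (j + 1) =
          insert (⟨{a}, c⟩ : Implication (Fin n)) (S ∪ binaryBelow imps c j) := by
        ext I
        constructor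
        · rintro (h | ⟨h, b, hb, hp, hcl⟩)
          · exact Or.inr (Or.inl h)
          · rcases Nat.lt_succ_iff_lt_or_eq.1 hb with hb | hb
            · exact Or.inr (Or.inr ⟨h, b, hb, hp, hcl⟩)
            · obtain rfl : b = a := Fin.ext hb
              left
              cases I
              simp_all
        · rintro (rfl | h | ⟨h, b, hb, hp, hcl⟩)
          · exact Or.inr ⟨rfl, a, by simp [ha], rfl, hmem⟩
          · exact Or.inl h
          · exact Or.inr ⟨h, b, by omega, hp, hcl⟩
      rw [hset]
      refine hout₁.insert ?_ rfl ?_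
      · rintro (h | ⟨-, b, hb, hp, -⟩)
        · exact hS _ h rfl
        · have : a = b := Finset.singleton_injective hp
          rw [← this] at hb
          exact absurd hb (lt_irrefl _)
      · simp [State.set, encodeImplication, hout₁.word, hc₁, hj₁, ha]
    · have hmem : c ∉ impClosure imps {a} \ {a} := fun h' => hiff.2 h' h
      have hset : binaryBelow imps c (j + 1) = binaryBelow imps c j := by
        ext I
        constructor
        · rintro ⟨h, b, hb, hp, hcl⟩
          rcases Nat.lt_succ_iff_lt_or_eq.1 hb with hb | hb
          · exact ⟨h, b, hb, hp, hcl⟩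
          · obtain rfl : b = a := Fin.ext hb
            exact absurd hcl hmem
        · rintro ⟨h, b, hb, hp, hcl⟩
          exact ⟨h, b, by omega, hp, hcl⟩
      rw [hset]
      exact Runs.skip ⟨.rfl, hout₁.sameOut ⟨rfl, rfl⟩⟩

/-- Write the maximal elements of the set in slot `reg 3` of the queue into bank `8`. -/
def maxProg : Prog :=
  .seq (.fill 10 8 (.const 0) (.read 4 (.add (.mul (.reg 3) (.reg 0)) (.reg 10))))
  (.loop 10 0 (.fill 11 8 (.const 0) (.mul (.read 8 (.reg 11)) (.sub (.const 1)
    (.mul (.mul (.read 4 (.add (.mul (.reg 3) (.reg 0)) (.reg 10)))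
      (.inClosure (.reg 10) (.reg 11))) (.dist (.reg 10) (.reg 11)))))))

theorem runs_maxProg (hN : Ample N imps) (hs : Ready imps s) {h : ℕ} (hh : s.reg 3 = h)
    {S : Set (Fin n)} (hS : Holds (s.mem 4) (h * n) S) :
    Runs N maxProg s fun s' => Frame 10 8 s s' ∧ SameOut s s' ∧
      Holds (s'.mem 8) 0 (maxElems (impClosure imps) S) := by
  classical
  have hn1 := hN.ground
  refine Runs.seq (Runs.fillSet 0 S (by omega) hs.ground hN.ground (fun _ _ _ => rfl) ?_ ?_)
  · intro i s' hi hr hm _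
    simp [hi, hm 4 (by omega), hr 3 (by omega), hr 0 (by omega), hh, hs.ground, hS i]
  set s₁ := s.fill 10 8 0 n (ind S)
  have f₁ : Frame 10 8 s s₁ := State.fill_frame
  have hs₁ := hs.frame f₁
  have h8 : Holds (s₁.mem 8) 0 S := State.fill_holds S
  refine Runs.loop' n 8 (fun j s' => Holds (s'.mem 8) 0
    {a ∈ S | ∀ b ∈ S, (b : ℕ) < j → b ≠ a → a ∉ impClosure imps {b}}) hs₁.ground (by omega)
    (by omega) (by simpa using h8) ?_ ?_
  · intro j hj s₂ f₂ hj₂ h8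
    have hs₂ := hs₁.frame f₂
    have h4₂ : s₂.mem 4 = s.mem 4 := (f₁.trans f₂).2 4 (by omega)
    have h3₂ : s₂.reg 3 = h := ((f₁.trans f₂).1 3 (by omega)).trans hh
    refine Runs.fillSet 0 {a ∈ S | ∀ b ∈ S, (b : ℕ) < j + 1 → b ≠ a → a ∉ impClosure imps {b}}
      (by omega) hs₂.ground hN.ground (fun _ _ _ => rfl) ?_
      ⟨State.fill_frame, State.fill_sameOut, by rw [State.set_mem]; exact State.fill_holds _⟩
    intro i s' hi hr hm hself
    have hs' := hs₂.frame (r := 2) (b := 2)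
      ⟨fun x hx => hr x (by omega), fun y hy => hm y (by omega)⟩
    have e10 : s'.reg 10 = j := (hr 10 (by omega)).trans hj₂
    have e4 : s'.mem 4 (h * n + j) = ind S j := by
      rw [hm 4 (by omega), h4₂]; exact hS ⟨j, hj⟩
    have e8 : s'.mem 8 i =
        ind {a ∈ S | ∀ b ∈ S, (b : ℕ) < j → b ≠ a → a ∉ impClosure imps {b}} i := by
      rw [zero_add] at hself; rw [hself, h8.zero]
    have hd := Expr.eval_dist_ne_zero (s := s') (a := .reg 10) (b := .reg 11)
    rw [Expr.eval_mul, Expr.eval_sub, Expr.eval_mul, Expr.eval_mul,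
      hs'.eval_inClosure (a := .reg 10) (b := .reg 11) (x := ⟨j, hj⟩) (y := i) e10 hi]
    simp only [Expr.eval_const, Expr.eval_read, Expr.eval_reg, Expr.eval_add, Expr.eval_mul, hi,
      e10, hr 3 (by omega), h3₂, hs'.ground, e4, e8] at hd ⊢
    have hstep : i ∈ {a ∈ S | ∀ b ∈ S, (b : ℕ) < j + 1 → b ≠ a → a ∉ impClosure imps {b}} ↔
        i ∈ {a ∈ S | ∀ b ∈ S, (b : ℕ) < j → b ≠ a → a ∉ impClosure imps {b}} ∧
          ¬ ((⟨j, hj⟩ : Fin n) ∈ S ∧ i ∈ impClosure imps {(⟨j, hj⟩ : Fin n)} ∧ j ≠ i) := by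
      constructor
      · rintro ⟨hiS, hmax⟩
        refine ⟨⟨hiS, fun b hb hbj => hmax b hb (by omega)⟩, ?_⟩
        rintro ⟨h1, h2, h3⟩
        exact hmax _ h1 (Nat.lt_succ_self j) (fun e => h3 (by rw [← e])) h2
      · rintro ⟨⟨hiS, hmax⟩, hno⟩
        refine ⟨hiS, fun b hb hbj hbi hib => ?_⟩
        rcases Nat.lt_succ_iff_lt_or_eq.1 hbj with hbj | hbj
        · exact hmax b hb hbj hbi hib
        · obtain rfl : b = ⟨j, hj⟩ := Fin.ext hbj
          exact hno ⟨hb, hib, fun e => hbi (Fin.ext e)⟩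
    have hiS : ind S j = if (⟨j, hj⟩ : Fin n) ∈ S then 1 else 0 := ind_val S ⟨j, hj⟩
    rw [hiS, ind_val, ind_val, ind_val, if_congr hstep rfl rfl]
    by_cases h1 : i ∈ {a ∈ S | ∀ b ∈ S, (b : ℕ) < j → b ≠ a → a ∉ impClosure imps {b}} <;>
      by_cases h2 : (⟨j, hj⟩ : Fin n) ∈ S <;>
        by_cases h3 : i ∈ impClosure imps {(⟨j, hj⟩ : Fin n)} <;> by_cases h4 : j = i <;>
          simp only [h1, h2, h3, if_true, if_false, true_and, false_and, not_false_iff,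
            one_mul, zero_mul, mul_zero, and_true, and_false] <;>
          (try simp)
    all_goals simp_all
    all_goals omega
  · intro s' f o h8
    refine ⟨f₁.trans f, SameOut.trans ⟨rfl, rfl⟩ o, ?_⟩
    convert h8 using 1
    ext a
    exact ⟨fun ⟨h1, h2⟩ => ⟨h1, fun b hb _ => h2 b hb⟩, fun ⟨h1, h2⟩ => ⟨h1, fun b hb => h2 b hb b.2⟩⟩

/-- Output the implication with conclusion `reg 2` the premise of which is in bank `8`. -/
def putProg : Prog :=
  .seq (.assign 12 (.const 0))
  (.seq (.loop 11 0 (.assign 12 (.add (.reg 12) (.read 8 (.reg 11)))))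
  (.seq (.put (.reg 2)) (.seq (.put (.reg 12))
  (.seq (.loop 11 0 (.ite (.read 8 (.reg 11)) (.put (.reg 11)) .skip)) .emit))))

theorem runs_putProg (hN : Ample N imps) (hn : s.reg 0 = n) {c : Fin n} (hc : s.reg 2 = c)
    {A : Finset (Fin n)} (hA : Holds (s.mem 8) 0 (A : Set (Fin n))) (hw : s.word = []) :
    Runs N putProg s fun s' => Frame 10 8 s s' ∧ s'.word = [] ∧
      s'.done = s.done ++ [encodeImplication ⟨A, c⟩] := by
  have hn1 := hN.ground
  set p : ℕ → Bool := fun j => ind (A : Set (Fin n)) j ≠ 0 with hp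
  have hsort := sort_map_val A
  rw [← hp] at hsort
  have hcard : ((List.range n).filter p).length = A.card := by rw [← hsort]; simp
  refine Runs.seq (Runs.assign (by simp) ?_)
  set s₁ := s.set 12 0
  have f₁ : Frame 11 9 s s₁ := Frame.set
  refine Runs.seq (Runs.loop' n 9 (fun j s' => s'.reg 12 = ((List.range j).filter p).length)
    ((f₁.1 0 (by omega)).trans hn) (by omega) (by omega) (by simp [State.set_reg]) ?_ ?_)
  · intro j hj s' f hj' h12
    have h8 : s'.mem 8 j = ind (A : Set (Fin n)) j := by
      rw [(f₁.trans f).2 8 (by omega)]; exact hA.zero ⟨j, hj⟩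
    have hval : (Expr.add (.reg 12) (.read 8 (.reg 11))).eval s' =
        ((List.range (j + 1)).filter p).length := by
      have := ind_le_one (A : Set (Fin n)) j
      simp only [Expr.eval_add, Expr.eval_reg, Expr.eval_read, hj', h12, h8, List.range_succ,
        List.filter_append, List.length_append, Nat.add_left_cancel_iff, List.filter_singleton]
      by_cases h : ind (A : Set (Fin n)) j = 0
      · simp [hp, h]
      · have h1 : ind (A : Set (Fin n)) j = 1 := by omega
        simp [hp, h1]
    have hle : ((List.range (j + 1)).filter p).length ≤ N :=
      (List.length_filter_le _ _).trans (by simp; omega)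
    refine Runs.assign (by rw [hval]; exact lt_two_pow_of_le hle) ⟨Frame.set, ⟨rfl, rfl⟩, ?_⟩
    rw [hval]; simp [State.set_reg]
  intro s₂ f₂ o₂ h12
  have f := f₁.trans f₂
  have hw₂ : s₂.word = [] := o₂.1.trans hw
  refine Runs.seq (Runs.put (Runs.seq (Runs.put (Runs.seq ?_))))
  refine Runs.loop n 9 (fun j s' => s'.done = s.done ∧
    s'.word = (c : ℕ) :: A.card :: (List.range j).filter p) ((f.1 0 (by omega)).trans hn) (by omega)
    (by omega) ⟨o₂.2, ?_⟩ ?_ ?_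
  · simp [hw₂, h12, hcard, f.1 2 (by omega), hc]
  · rintro j hj s' f' hj' ⟨hd, hw'⟩
    have h8 : s'.mem 8 j = ind (A : Set (Fin n)) j := by
      rw [f'.2 8 (by omega)]
      exact (congrFun (f.2 8 (by omega)) j).trans (hA.zero ⟨j, hj⟩)
    refine Runs.ite (fun h => Runs.put ⟨⟨fun _ _ => rfl, fun _ _ => rfl⟩, hd, ?_⟩)
      (fun h => Runs.skip ⟨.rfl, hd, ?_⟩)
    · simp only [Expr.eval_read, Expr.eval_reg, hj', h8] at h
      simp [State.set, hw', hj', List.range_succ, List.filter_append, hp, h]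
    · simp only [Expr.eval_read, Expr.eval_reg, hj', h8] at h
      simp [State.set, hw', List.range_succ, List.filter_append, hp, h]
  · rintro s₃ f₃ - ⟨hd, hw₃⟩
    refine Runs.emit ⟨?_, rfl, ?_⟩
    · refine ⟨fun x hx => ?_, fun y hy => ?_⟩
      · exact (f₃.1 x (by omega)).trans (f.1 x (by omega))
      · exact (f₃.2 y (by omega)).trans (f.2 y (by omega))
    · simp only [hd, hw₃, encodeImplication, hsort]

end RAM

namespace RAM

variable {n N : ℕ} {imps : List (Implication (Fin n))} {s : State} {Q : State → Prop}

/-! ### The traversal of the minimal down-sets -/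

/-- Begin the traversal for `reg 2`: the queue consists of the closure of this element. -/
def startProg : Prog :=
  .seq (.write 2 (.const 0) (.const 0))
  (.seq (.assign 3 (.const 0))
  (.seq (.fill 10 6 (.const 0) (.inClosure (.reg 2) (.reg 10))) pushProg))

theorem runs_startProg (hN : Ample N imps) (hst : IsStandard (impClosure imps))
    (hs : Ready imps s) {c : Fin n} (hc : s.reg 2 = c) (hmark : ∀ a, s.mem 3 a ≤ c) :
    Runs N startProg s fun s' => Frame 3 2 s s' ∧ SameOut s s' ∧ s'.reg 3 = 0 ∧
      IsQueue imps c s' [impClosure imps {c}] := by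
  refine Runs.seq (Runs.write (by simp) (Runs.seq (Runs.assign (by simp) ?_)))
  simp only [Expr.eval_const]
  set s₁ := (s.store 2 0 0).set 3 0
  have f₁ : Frame 3 2 s s₁ := (Frame.rfl.then_store (r := 3)).then_set
  have hs₁ := hs.frame f₁
  refine Runs.seq (Runs.fillSet 0 (impClosure imps {c}) (by omega) hs₁.ground hN.ground
    (fun _ _ _ => rfl) ?_ ?_)
  · intro j s' hj hr hm _
    have hs' := hs₁.frame (r := 2) (b := 2)
      ⟨fun x hx => hr x (by omega), fun y hy => hm y (by omega)⟩
    exact hs'.eval_inClosure (a := .reg 2) (b := .reg 10)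
      ((hr 2 (by omega)).trans ((f₁.1 2 (by omega)).trans hc)) hj
  set s₂ := s₁.fill 10 6 0 n (ind (impClosure imps {c}))
  have f₂ : Frame 3 2 s s₂ := f₁.then_fill
  have h3 : s₂.reg 3 = 0 := by simp [s₂, s₁, State.fill]
  have hq : IsQueue imps c s₂ [] := by
    refine ⟨?_, List.nodup_nil, by simp, by simp, fun S => ?_, fun a => ?_⟩
    · simp [s₂, s₁, State.fill, State.store_mem]
    · have : s₂.mem 3 (mask S n) ≤ c := by
        simpa [s₂, s₁, State.fill, State.store_mem] using hmark (mask S n)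
      simp only [List.not_mem_nil, iff_false]
      omega
    · have : s₂.mem 3 a ≤ c := by
        simpa [s₂, s₁, State.fill, State.store_mem] using hmark a
      omega
  refine (runs_pushProg hN (hs.frame f₂) ((f₂.1 2 (by omega)).trans hc) hq (State.fill_holds _)
    (isDownSet_singleton c) ((impClosure imps).le_closure _ (mem_closure_self c))).mono ?_
  rintro s₃ ⟨f₃, o₃, S', hS', hmin, hcase⟩
  obtain rfl := (hst.isMinDown c).2.2 S' hS' hmin.1 hmin.2.1
  refine ⟨f₂.trans f₃, (SameOut.trans ⟨rfl, rfl⟩ o₃ : SameOut s s₃),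
    (f₃.1 3 (by omega)).trans h3, ?_⟩
  rcases hcase with ⟨h, -⟩ | ⟨-, h⟩
  · simp at h
  · exact h

/-- The implications with conclusion `c` the premises of which are the maximal elements of the
members `1, ..., h - 1` of `L`. -/
def visitedImps (imps : List (Implication (Fin n))) (c : Fin n) (L : List (Set (Fin n))) (h : ℕ) :
    Set (Implication (Fin n)) :=
  {I | I.concl = c ∧ ∃ i, 0 < i ∧ i < h ∧ ∃ hi : i < L.length,
    (I.prem : Set (Fin n)) = maxElems (impClosure imps) L[i]}

/-- The state of the traversal for `c` after `h` members of the queue have been treated, where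
the implications of `S₀` have been output before the traversal. -/
structure Traverses (imps : List (Implication (Fin n))) (c : Fin n)
    (S₀ : Set (Implication (Fin n))) (h : ℕ) (L : List (Set (Fin n))) (s : State) : Prop where
  ready : Ready imps s
  target : s.reg 2 = c
  head : s.reg 3 = h
  head_le : h ≤ L.length
  queue : IsQueue imps c s L
  root : L[0]? = some (impClosure imps {c})
  expanded : ∀ i < h, ∀ hi : i < L.length, ∀ I ∈ imps, ∃ S' ∈ L, S' ⊆ neighbor imps I L[i]
  output : HasOutput s (S₀ ∪ visitedImps imps c L h)

/-- Treat the next member of the queue. -/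
def visitProg : Prog :=
  .seq (.ite (.reg 3) (.seq maxProg putProg) .skip)
    (.seq expandProg (.assign 3 (.add (.reg 3) (.const 1))))

theorem visitedImps_succ_of_pos {c : Fin n} {L : List (Set (Fin n))} {h : ℕ} (h0 : 0 < h)
    (hh : h < L.length) {A : Finset (Fin n)}
    (hA : (A : Set (Fin n)) = maxElems (impClosure imps) L[h]) :
    visitedImps imps c L (h + 1) = insert ⟨A, c⟩ (visitedImps imps c L h) := by
  ext I
  constructor
  · rintro ⟨hI, i, hi0, hih, hi, hp⟩
    rcases Nat.lt_succ_iff_lt_or_eq.1 hih with hih | rfl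
    · exact Or.inr ⟨hI, i, hi0, hih, hi, hp⟩
    · left
      obtain ⟨B, d⟩ := I
      obtain rfl : d = c := hI
      obtain rfl : B = A := Finset.coe_injective (hp.trans hA.symm)
      rfl
  · rintro (rfl | ⟨hI, i, hi0, hih, hi, hp⟩)
    · exact ⟨rfl, h, h0, by omega, hh, hA⟩
    · exact ⟨hI, i, hi0, by omega, hi, hp⟩

theorem visitedImps_of_le_one {c : Fin n} {L : List (Set (Fin n))} {h : ℕ} (hh : h ≤ 1) :
    visitedImps imps c L h = ∅ := by
  ext I
  simp only [Set.mem_empty_iff_false, iff_false]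
  rintro ⟨-, i, h1, h2, -⟩
  omega

theorem visitedImps_congr {c : Fin n} {L L' : List (Set (Fin n))} {h : ℕ} (hp : L <+: L')
    (hh : h ≤ L.length) : visitedImps imps c L' h = visitedImps imps c L h := by
  ext I
  constructor
  · rintro ⟨hI, i, hi0, hih, hi, e⟩
    exact ⟨hI, i, hi0, hih, by omega, by rw [e, hp.getElem (by omega)]⟩
  · rintro ⟨hI, i, hi0, hih, hi, e⟩
    exact ⟨hI, i, hi0, hih, hi.trans_le hp.length_le, by rw [e, hp.getElem hi]⟩

theorem runs_visitProg (hN : Ample N imps) (hst : IsStandard (impClosure imps)) {c : Fin n}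
    {S₀ : Set (Implication (Fin n))}
    (hS₀ : ∀ I ∈ S₀, I.concl = c → ∃ a : Fin n, I.prem = {a} ∧ c ∈ impClosure imps {a})
    {h : ℕ} {L : List (Set (Fin n))} (ht : Traverses imps c S₀ h L s) (hh : h < L.length) :
    Runs N visitProg s fun s' => (∃ L', Traverses imps c S₀ (h + 1) L' s') ∧
      (h ≠ 0 → s'.done ≠ s.done) := by
  classical
  have hroot : ∀ h0 : 0 < L.length, L[0] = impClosure imps {c} := fun h0 => by
    have := ht.root
    rwa [List.getElem?_eq_getElem h0, Option.some_inj] at this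
  have hout : Runs N (.ite (.reg 3) (.seq maxProg putProg) .skip) s fun s' => Frame 10 8 s s' ∧
      HasOutput s' (S₀ ∪ visitedImps imps c L (h + 1)) ∧ (h ≠ 0 → s'.done ≠ s.done) := by
    refine Runs.ite (fun h3 => ?_) (fun h3 => ?_)
    · have hpos : 0 < h := by
        have := ht.head; simp only [Expr.eval_reg] at h3; omega
      obtain ⟨A, hA⟩ : ∃ A : Finset (Fin n), (A : Set (Fin n)) = maxElems (impClosure imps) L[h] :=
        ⟨(maxElems (impClosure imps) L[h]).toFinset, by simp⟩
      refine Runs.seq ((runs_maxProg hN ht.ready ht.head (ht.queue.slot h hh)).mono ?_)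
      rintro s₁ ⟨f₁, o₁, h8⟩
      rw [← hA] at h8
      refine (runs_putProg hN (ht.ready.frame f₁).ground ((f₁.1 2 (by omega)).trans ht.target) h8
        (o₁.1.trans ht.output.word)).mono ?_
      rintro s₂ ⟨f₂, hw, hd⟩
      rw [o₁.2] at hd
      refine ⟨f₁.trans f₂, ?_, fun _ => by simp [hd]⟩
      rw [visitedImps_succ_of_pos hpos hh hA, Set.union_insert]
      refine ht.output.insert ?_ hw hd
      have hbin : ∀ i (hi : i < L.length), binClosure (impClosure imps)
          (maxElems (impClosure imps) L[i]) = L[i] := fun i hi =>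
        binClosure_maxElems hst (ht.queue.isMinDown _ (List.getElem_mem hi)).1
      rintro (hI | ⟨-, i, hi0, hih, hi, hp⟩)
      · obtain ⟨a, ha, hca⟩ := hS₀ _ hI rfl
        simp only at ha
        have h1 := hbin h hh
        rw [← hA, ha, Finset.coe_singleton] at h1
        have hcL : c ∈ L[h] := by rw [← h1]; simpa [binClosure] using hca
        have := (ht.queue.isMinDown _ (List.getElem_mem hh)).eq_of_mem hcL
        rw [← hroot (by omega)] at this
        have := (ht.queue.nodup.getElem_inj_iff).1 this
        omega
      · have h1 := hbin h hh
        rw [← hA, hp, hbin i hi] at h1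
        have := (ht.queue.nodup.getElem_inj_iff).1 h1
        omega
    · have hz : h = 0 := by
        have := ht.head; simp only [Expr.eval_reg] at h3; omega
      refine Runs.skip ⟨.rfl, ?_, fun hne => absurd hz hne⟩
      rw [visitedImps_of_le_one (by omega), ← visitedImps_of_le_one (h := h) (by omega)]
      exact ht.output
  refine Runs.seq (hout.mono ?_)
  rintro s₁ ⟨f₁, hout₁, hne⟩
  have hs₁ := ht.ready.frame f₁
  have h2₁ := (f₁.1 2 (by omega)).trans ht.target
  have h3₁ := (f₁.1 3 (by omega)).trans ht.head
  refine Runs.seq ((runs_expandProg hN hs₁ h2₁ h3₁ (ht.queue.frame f₁) hh).mono ?_)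
  rintro s₂ ⟨f₂, o₂, L', hpre, hL', hnb⟩
  have h3₂ := (f₂.1 3 (by omega)).trans h3₁
  have hlen := length_le_of_nodup ht.queue.nodup
  have hlen' := hpre.length_le
  have hval : (Expr.add (.reg 3) (.const 1)).eval s₂ = h + 1 := by simp [h3₂]
  refine Runs.assign ?_ ⟨⟨L', ?_⟩, fun h0 => ?_⟩
  · rw [hval]; exact lt_of_le_of_lt (by omega) hN.two_pow_lt
  · rw [hval]
    have f₃ : Frame 2 2 s₂ (s₂.set 3 (h + 1)) := Frame.set
    refine ⟨(hs₁.frame f₂).frame f₃, ?_, by simp, by omega, hL'.congr rfl rfl rfl, ?_, ?_, ?_⟩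
    · rw [State.set_reg_of_ne (by omega)]; exact (f₂.1 2 (by omega)).trans h2₁
    · rw [← ht.root]
      have h0 : 0 < L.length := by omega
      rw [List.getElem?_eq_getElem h0, List.getElem?_eq_getElem (by omega), hpre.getElem h0]
    · intro i hi hi' I hI
      rw [← hpre.getElem (by omega)]
      rcases Nat.lt_succ_iff_lt_or_eq.1 hi with hi | rfl
      · obtain ⟨S', hS', hsub⟩ := ht.expanded i hi (by omega) I hI
        exact ⟨S', hpre.subset hS', hsub⟩
      · exact hnb I hI
    · rw [visitedImps_congr hpre (by omega)]
      exact hout₁.sameOut (o₂.trans ⟨rfl, rfl⟩)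
  · rw [State.set_done, o₂.2]; exact hne h0

/-- The implications of the `D`-base with conclusion less than `j`. -/
def dBaseBelow (imps : List (Implication (Fin n))) (j : ℕ) : Set (Implication (Fin n)) :=
  {I ∈ dBase (impClosure imps) | (I.concl : ℕ) < j}

theorem Traverses.output_eq (hst : IsStandard (impClosure imps)) {c : Fin n}
    {L : List (Set (Fin n))}
    (ht : Traverses imps c (dBaseBelow imps c ∪ binaryBelow imps c n) L.length L s) :
    HasOutput s (dBaseBelow imps (c + 1)) := by
  have h0 : 0 < L.length := by
    by_contra h
    have := ht.root
    rw [List.getElem?_eq_none (by omega)] at this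
    simp at this
  have hroot : L[0] = impClosure imps {c} := by
    have := ht.root
    rwa [List.getElem?_eq_getElem h0, Option.some_inj] at this
  have hall : ∀ T, IsMinDown (impClosure imps) c T → T ∈ L := fun T hT => by
    refine mem_of_neighbor_closed (L := {T | T ∈ L}) ht.queue.isMinDown
      (hroot ▸ List.getElem_mem h0) ?_ hT
    intro S hS I hI
    obtain ⟨i, hi, rfl⟩ := List.mem_iff_getElem.1 hS
    exact ht.expanded i hi hi I hI
  have heq : dBaseBelow imps c ∪ binaryBelow imps c n ∪ visitedImps imps c L L.length =
      dBaseBelow imps (c + 1) := by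
    ext I
    constructor
    · rintro ((⟨h1, h2⟩ | ⟨h1, a, -, h2⟩) | ⟨h1, i, hi0, -, hi, h2⟩)
      · exact ⟨h1, by omega⟩
      · exact ⟨Or.inl ⟨a, by rw [h1]; exact h2⟩, by rw [h1]; omega⟩
      · have hm := ht.queue.isMinDown _ (List.getElem_mem hi)
        refine ⟨Or.inr ((isDGen_iff hst).2 ⟨L[i], h1 ▸ hm, fun hc => ?_, h2.symm⟩),
          by rw [h1]; omega⟩
        have := hm.eq_of_mem (h1 ▸ hc)
        rw [← hroot] at this
        have := (ht.queue.nodup.getElem_inj_iff).1 this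
        omega
    · rintro ⟨h1, h2⟩
      rcases Nat.lt_succ_iff_lt_or_eq.1 h2 with h2 | h2
      · exact Or.inl (Or.inl ⟨h1, h2⟩)
      · have hc : I.concl = c := Fin.ext h2
        rcases h1 with ⟨a, ha, hca⟩ | h1
        · exact Or.inl (Or.inr ⟨hc, a, a.2, ha, hc ▸ hca⟩)
        · obtain ⟨T, hT, hcT, hA⟩ := (isDGen_iff hst).1 h1
          obtain ⟨i, hi, rfl⟩ := List.mem_iff_getElem.1 (hall T (hc ▸ hT))
          refine Or.inr ⟨hc, i, ?_, hi, hi, hA.symm⟩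
          rcases Nat.eq_zero_or_pos i with rfl | hi0
          · exact absurd (by rw [hroot, hc]; exact mem_closure_self c) hcT
          · exact hi0
  rw [← heq]
  exact ht.output

/-! ### Delays -/

/-- All delays up to now were at most `d`, and at most `E` units of time have passed since the last
output. -/
def Timely (d E : ℕ) (σ : Config) : Prop :=
  List.IsChain (fun s t => t ≤ s + d) (0 :: σ.outs.map Prod.snd) ∧
    ∀ t ∈ (0 :: σ.outs.map Prod.snd).getLast?, σ.time ≤ t + E

theorem Timely.mono {d E E' : ℕ} {σ : Config} (h : Timely d E σ) (hE : E ≤ E') : Timely d E' σ :=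
  ⟨h.1, fun t ht => (h.2 t ht).trans (by omega)⟩

theorem Timely.extends {d E b : ℕ} {σ τ : Config} (h : Timely d E σ) (hx : Extends σ τ)
    (ht : τ.time ≤ σ.time + b) (hd : E + b ≤ d) :
    Timely d (E + b) τ ∧ (τ.outs ≠ σ.outs → Timely d b τ) := by
  obtain ⟨hle, new, hnew, hb⟩ := hx
  have hb' : ∀ t ∈ new.map Prod.snd, σ.time ≤ t ∧ t ≤ τ.time := by
    intro t ht
    obtain ⟨o, ho, rfl⟩ := List.mem_map.1 ht
    exact hb o ho
  have hchain : List.IsChain (fun s t => t ≤ s + d) (0 :: τ.outs.map Prod.snd) := by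
    rw [hnew, List.map_append, ← List.cons_append, List.isChain_append]
    refine ⟨h.1, ?_, fun x hx y hy => ?_⟩
    · refine List.Pairwise.isChain (List.pairwise_of_forall_mem_list fun x hx y hy => ?_)
      have := hb' x hx
      have := hb' y hy
      omega
    · have := h.2 x hx
      have := hb' y (List.mem_of_mem_head? hy)
      omega
  have hlast : new ≠ [] → ∀ t ∈ (0 :: τ.outs.map Prod.snd).getLast?, τ.time ≤ t + b := by
    intro hne t ht
    rw [hnew, List.map_append, ← List.cons_append,
      List.getLast?_append_of_ne_nil _ (by simpa using hne)] at ht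
    have := hb' t (List.mem_of_getLast? ht)
    omega
  by_cases hne : new = []
  · subst hne
    rw [List.append_nil] at hnew
    refine ⟨⟨hchain, fun t ht => ?_⟩, fun h' => absurd hnew h'⟩
    rw [hnew] at ht
    have := h.2 t ht
    omega
  · exact ⟨⟨hchain, fun t ht => (hlast hne t ht).trans (by omega)⟩, fun _ => ⟨hchain, hlast hne⟩⟩

theorem Runs.exec {P : Prog} {σ : Config} {d E : ℕ} (h : Runs N P σ.st Q) (hok : Ok N σ.st)
    (ht : Timely d E σ) (hd : E + P.bound N ≤ d) :
    ∃ τ, Exec P σ τ ∧ Ok N τ.st ∧ Q τ.st ∧ Timely d (E + P.bound N) τ ∧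
      (τ.st.done ≠ σ.st.done → Timely d (P.bound N) τ) := by
  obtain ⟨s', t, o, q⟩ := h hok
  obtain ⟨τ, x, rfl, ht', ext⟩ := t σ rfl
  have := ht.extends ext ht' hd
  exact ⟨τ, x, o, q, this.1, fun hne => this.2 fun e => hne (by simp [Config.st, e])⟩

theorem Timely.tick {e : Expr} {σ : Config} {d E : ℕ} (ht : Timely d E σ) (hok : Ok N σ.st)
    (hd : E + (1 + e.bound N) ≤ d) : Timely d (E + (1 + e.bound N)) (σ.tick (1 + e.cost σ)) :=
  (ht.extends (Extends.tick _) (by have := e.cost_le hok; simp only [Config.tick]; omega) hd).1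

/-- The test of the loop of the traversal. -/
def pendingExpr : Expr := .sub (.read 2 (.const 0)) (.reg 3)

/-- A bound on the time for a member of the queue. -/
def visitTime (N : ℕ) : ℕ := 1 + pendingExpr.bound N + visitProg.bound N

theorem exec_traversal (hN : Ample N imps) (hst : IsStandard (impClosure imps)) {c : Fin n}
    {S₀ : Set (Implication (Fin n))}
    (hS₀ : ∀ I ∈ S₀, I.concl = c → ∃ a : Fin n, I.prem = {a} ∧ c ∈ impClosure imps {a})
    {d E : ℕ} (hd : E + 2 * visitTime N ≤ d) (k : ℕ) :
    ∀ (σ : Config) (h : ℕ) (L : List (Set (Fin n))), 2 ^ n - h ≤ k → Ok N σ.st →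
      Traverses imps c S₀ h L σ.st → Timely d (E + if h = 0 then 0 else visitTime N) σ →
      ∃ τ L', Exec (.while pendingExpr visitProg) σ τ ∧ Ok N τ.st ∧
        Traverses imps c S₀ L'.length L' τ.st ∧ Timely d (E + 2 * visitTime N) τ := by
  have htest : ∀ (σ : Config) (h : ℕ) (L : List (Set (Fin n))), Traverses imps c S₀ h L σ.st →
      pendingExpr.val σ = L.length - h := by
    intro σ h L ht
    rw [Expr.val_eq_eval]
    simp [pendingExpr, ht.queue.length, ht.head]
  have hdone : ∀ (σ : Config) (h : ℕ) (L : List (Set (Fin n))), Ok N σ.st →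
      Traverses imps c S₀ h L σ.st → Timely d (E + if h = 0 then 0 else visitTime N) σ →
      ¬ h < L.length → ∃ τ L', Exec (.while pendingExpr visitProg) σ τ ∧ Ok N τ.st ∧
        Traverses imps c S₀ L'.length L' τ.st ∧ Timely d (E + 2 * visitTime N) τ := by
    intro σ h L hok ht htime hlt
    have hhL : h = L.length := le_antisymm ht.head_le (by omega)
    refine ⟨_, L, .while_false _ _ _ (by rw [htest σ h L ht]; omega), hok, hhL ▸ ht, ?_⟩
    have hle : (E + if h = 0 then 0 else visitTime N) + (1 + pendingExpr.bound N) ≤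
        E + 2 * visitTime N := by
      simp only [visitTime]; split_ifs <;> omega
    exact (htime.tick hok (hle.trans hd)).mono hle
  induction k with
  | zero =>
    intro σ h L hk hok ht htime
    have := length_le_of_nodup ht.queue.nodup
    exact hdone σ h L hok ht htime (by omega)
  | succ k ih =>
    intro σ h L hk hok ht htime
    by_cases hlt : h < L.length
    · have hlen := length_le_of_nodup ht.queue.nodup
      have hle : (E + if h = 0 then 0 else visitTime N) + (1 + pendingExpr.bound N) +
          visitProg.bound N ≤ E + 2 * visitTime N := by
        simp only [visitTime]; split_ifs <;> omega
      have htick := htime.tick (e := pendingExpr) hok (by omega)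
      obtain ⟨τ, x, hok', ⟨⟨L', ht'⟩, hne⟩, h1, h2⟩ :=
        Runs.exec (σ := σ.tick (1 + pendingExpr.cost σ)) (runs_visitProg hN hst hS₀ ht hlt) hok
          htick (by omega)
      have htime' : Timely d (E + if h + 1 = 0 then 0 else visitTime N) τ := by
        rw [if_neg (Nat.succ_ne_zero h)]
        by_cases h0 : h = 0
        · refine h1.mono ?_
          rw [if_pos h0]; simp only [visitTime]; omega
        · refine (h2 (hne h0)).mono ?_
          simp only [visitTime]; omega
      obtain ⟨υ, L'', y, hok'', ht'', htime''⟩ := ih τ (h + 1) L' (by omega) hok' ht' htime'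
      exact ⟨υ, L'', .while_true _ _ _ _ _ (by rw [htest σ h L ht]; omega) x y, hok'', ht'', htime''⟩
    · exact hdone σ h L hok ht htime hlt

/-! ### The algorithm -/

/-- Output the implications of the `D`-base with conclusion `reg 2`. -/
def roundProg : Prog :=
  .seq (.seq binaryProg startProg)
    (.seq (.while pendingExpr visitProg) (.assign 2 (.add (.reg 2) (.const 1))))

/-- The test of the loop over the conclusions. -/
def moreExpr : Expr := .sub (.reg 0) (.reg 2)

/-- Output the `D`-base. -/
def dBaseProg : Prog :=
  .seq (.seq initProg (.assign 2 (.const 0))) (.while moreExpr roundProg)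

/-- The state after the implications with conclusion less than `j` have been output. -/
structure AfterRounds (imps : List (Implication (Fin n))) (j : ℕ) (s : State) : Prop where
  ready : Ready imps s
  target : s.reg 2 = j
  mark_le : ∀ a, s.mem 3 a ≤ j
  output : HasOutput s (dBaseBelow imps j)

/-- A bound on the time for a round without the members of the queue other than two. -/
def roundTime (N : ℕ) : ℕ :=
  (1 + moreExpr.bound N) + (binaryProg.bound N + startProg.bound N) + 2 * visitTime N +
    (Prog.assign 2 (.add (.reg 2) (.const 1))).bound N

theorem exec_round (hN : Ample N imps) (hst : IsStandard (impClosure imps)) (c : Fin n)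
    {d E : ℕ} (hd : E + roundTime N ≤ d) {σ : Config} (hok : Ok N σ.st)
    (hs : AfterRounds imps c σ.st) (ht : Timely d E σ) :
    ∃ τ, Exec roundProg (σ.tick (1 + moreExpr.cost σ)) τ ∧ Ok N τ.st ∧
      AfterRounds imps (c + 1) τ.st ∧ Timely d (E + roundTime N) τ := by
  rw [roundTime] at hd
  have hn1 := hN.ground
  have hpre : Runs N (.seq binaryProg startProg) σ.st
      (Traverses imps c (dBaseBelow imps c ∪ binaryBelow imps c n) 0 [impClosure imps {c}]) := by
    refine Runs.seq ((runs_binaryProg hN hs.ready hs.target (fun I hI e => ?_) hs.output).mono ?_)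
    · have := hI.2
      rw [e] at this
      exact absurd this (lt_irrefl _)
    rintro s₁ ⟨f₁, hout₁⟩
    refine (runs_startProg hN hst (hs.ready.frame f₁) ((f₁.1 2 (by omega)).trans hs.target)
      (by rw [f₁.2 3 (by omega)]; exact hs.mark_le)).mono ?_
    rintro s₂ ⟨f₂, o₂, h3, hq⟩
    refine ⟨(hs.ready.frame f₁).frame f₂, (f₂.1 2 (by omega)).trans
      ((f₁.1 2 (by omega)).trans hs.target), h3, Nat.zero_le _, hq, rfl,
      fun i hi => absurd hi (Nat.not_lt_zero _), ?_⟩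
    rw [visitedImps_of_le_one (by omega), Set.union_empty]
    exact hout₁.sameOut o₂
  have htick := ht.tick (e := moreExpr) hok (by omega)
  obtain ⟨τ, x, hok₁, ht₁, htime₁, -⟩ :=
    Runs.exec (σ := σ.tick (1 + moreExpr.cost σ)) hpre hok htick
      (by simp only [Prog.bound] at hd ⊢; omega)
  obtain ⟨υ, L, y, hok₂, ht₂, htime₂⟩ := exec_traversal hN hst
    (by
      rintro I (hI | ⟨-, a, -, ha, hca⟩) e
      · have := hI.2
        rw [e] at this
        exact absurd this (lt_irrefl _)
      · exact ⟨a, ha, hca.1⟩)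
    (E := E + (1 + moreExpr.bound N) + (Prog.seq binaryProg startProg).bound N) (d := d)
    (by simp only [Prog.bound] at hd ⊢; omega) (2 ^ n) τ 0 _ (Nat.sub_le _ _) hok₁ ht₁
    (by rw [if_pos rfl]; exact htime₁)
  have hval : (Expr.add (.reg 2) (.const 1)).eval υ.st = c + 1 := by simp [ht₂.target]
  have hfin : Runs N (.assign 2 (.add (.reg 2) (.const 1))) υ.st (AfterRounds imps (c + 1)) := by
    refine Runs.assign (by rw [hval]; exact lt_two_pow_of_le (by omega)) ?_
    rw [hval]
    exact ⟨ht₂.ready.frame (Frame.set (r := 2) (b := 2)), by simp, ht₂.queue.mark_le,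
      (ht₂.output_eq hst).sameOut ⟨rfl, rfl⟩⟩
  obtain ⟨φ, z, hok₃, h₃, htime₃, -⟩ := hfin.exec hok₂ htime₂
    (by simp only [Prog.bound] at hd ⊢; omega)
  refine ⟨φ, .seq _ _ _ _ _ x (.seq _ _ _ _ _ y z), hok₃, h₃, htime₃.mono ?_⟩
  simp only [Prog.bound, roundTime]; omega

theorem exec_rounds (hN : Ample N imps) (hst : IsStandard (impClosure imps)) {d : ℕ} (k : ℕ) :
    ∀ (E j : ℕ) (σ : Config), j + k = n → E + k * roundTime N + (1 + moreExpr.bound N) ≤ d →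
      Ok N σ.st → AfterRounds imps j σ.st → Timely d E σ →
      ∃ τ, Exec (.while moreExpr roundProg) σ τ ∧ HasOutput τ.st (dBaseBelow imps n) ∧
        Timely d d τ := by
  induction k with
  | zero =>
    intro E j σ hj hd hok hs ht
    obtain rfl : j = n := by omega
    have hval : moreExpr.val σ = 0 := by
      rw [Expr.val_eq_eval]; simp [moreExpr, hs.ready.ground, hs.target]
    exact ⟨_, .while_false _ _ _ hval, hs.output, (ht.tick hok (by omega)).mono (by omega)⟩
  | succ k ih =>
    intro E j σ hj hd hok hs ht
    rw [Nat.succ_mul] at hd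
    have hval : moreExpr.val σ ≠ 0 := by
      rw [Expr.val_eq_eval]; simp [moreExpr, hs.ready.ground, hs.target]; omega
    obtain ⟨τ, x, hok₁, hs₁, ht₁⟩ := exec_round hN hst ⟨j, by omega⟩ (d := d) (E := E) (by omega)
      hok hs ht
    obtain ⟨υ, y, hout, ht₂⟩ := ih (E + roundTime N) (j + 1) τ (by omega) (by omega) hok₁ hs₁ ht₁
    exact ⟨υ, .while_true _ _ _ _ _ hval x y, hout, ht₂⟩

theorem mul_roundTime_le (hN : 2 ≤ N) {k : ℕ} (hk : k ≤ N) :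
    initProg.bound N + (Prog.assign 2 (.const 0)).bound N + k * roundTime N +
      (1 + moreExpr.bound N) ≤ dBaseProg.bound N := by
  have h1 : roundTime N ≤ 1 + moreExpr.bound N + roundProg.bound N := by
    have : 2 * visitTime N ≤ N * visitTime N := Nat.mul_le_mul_right _ hN
    have e : roundProg.bound N = (binaryProg.bound N + startProg.bound N) +
        ((N * visitTime N + (1 + pendingExpr.bound N)) +
          (Prog.assign 2 (.add (.reg 2) (.const 1))).bound N) := rfl
    rw [e, roundTime]; omega
  have h2 : k * roundTime N ≤ N * (1 + moreExpr.bound N + roundProg.bound N) :=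
    Nat.mul_le_mul hk h1
  have e : dBaseProg.bound N = (initProg.bound N + (Prog.assign 2 (.const 0)).bound N) +
      (N * (1 + moreExpr.bound N + roundProg.bound N) + (1 + moreExpr.bound N)) := rfl
  rw [e]; omega

theorem ok_start (hN : Ample N imps) : Ok N (start (encodeIB n imps)).st := by
  have hn1 := hN.ground
  have hmem : ∀ v ∈ encodeIB n imps, v ≤ N := by
    intro v hv
    simp only [encodeIB, encodeImplication, List.mem_cons, List.mem_flatMap, List.mem_map] at hv
    rcases hv with rfl | rfl | ⟨I, -, rfl | rfl | ⟨a, -, rfl⟩⟩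
    · omega
    · exact hN.count
    · have := I.concl.2; omega
    · exact hN.card.trans (by omega)
    · have := a.2; omega
  refine ⟨fun x => by simp [Config.st, start], fun b a => ?_⟩
  simp only [Config.st, start]
  split_ifs
  · by_cases h : a < (encodeIB n imps).length
    · rw [List.getD_eq_getElem _ _ h]
      exact lt_two_pow_of_le (hmem _ (List.getElem_mem h))
    · rw [List.getD_eq_default _ _ (by omega)]; simp
  · simp

theorem enumerates_dBaseProg (hN : Ample N imps) (hN2 : 2 ≤ N)
    (hst : IsStandard (impClosure imps)) :
    EnumeratesWithDelay dBaseProg (encodeIB n imps)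
      (encodeImplication '' dBase (impClosure imps)) (dBaseProg.bound N) := by
  have hn1 := hN.ground
  have hbound := mul_roundTime_le hN2 (k := n) (by omega)
  set d := dBaseProg.bound N
  set σ := start (encodeIB n imps)
  have ht : Timely d 0 σ := ⟨by simp [σ, start], by simp [σ, start]⟩
  have hinput : IsInput (σ.st.mem 0) imps := by
    have := isInput_encodeIB imps
    simpa [σ, start, Config.st] using this
  have hpre : Runs N (.seq initProg (.assign 2 (.const 0))) σ.st (AfterRounds imps 0) := by
    refine Runs.seq ((runs_initProg hN hinput).mono ?_)
    rintro s' ⟨hs', o', h3⟩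
    refine Runs.assign (by simp) ⟨hs'.frame (Frame.set (r := 2) (b := 2)), by simp, fun a => ?_, ?_⟩
    · rw [State.set_mem, h3]; simp [σ, start, Config.st]
    · have : dBaseBelow imps 0 = ∅ := by ext I; simp [dBaseBelow]
      rw [this]
      refine ⟨o'.1, ?_, ?_⟩
      · rw [State.set_done, o'.2]; simp [σ, start, Config.st]
      · rw [State.set_done, o'.2]; simp [σ, start, Config.st]
  obtain ⟨τ, x, hok₁, hs₁, ht₁, -⟩ := hpre.exec (ok_start hN) ht
    (by simp only [Prog.bound] at hbound ⊢; omega)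
  obtain ⟨υ, y, hout, ht₂⟩ := exec_rounds hN hst (d := d) n _ 0 τ (by omega)
    (by simp only [Prog.bound] at hbound ⊢; omega) hok₁ hs₁ ht₁
  refine ⟨υ, .seq _ _ _ _ _ x y, hout.word, hout.nodup, ?_, ?_⟩
  · have : dBaseBelow imps n = dBase (impClosure imps) := by
      ext I; exact ⟨fun h => h.1, fun h => ⟨h, I.concl.2⟩⟩
    rw [← this]
    ext w
    exact hout.mem w
  · rw [List.isChain_append]
    refine ⟨ht₂.1, by simp, fun t h t' h' => ?_⟩
    simp only [List.head?_cons, Option.mem_def, Option.some.injEq] at h'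
    subst h'
    exact ht₂.2 t h

end RAM

theorem theorem5 :
    ∃ (P : RAM.Prog) (p : Polynomial ℕ),
      ∀ (n : ℕ) (imps : List (Implication (Fin n))),
        IsStandard (impClosure imps) →
          RAM.EnumeratesWithDelay P (encodeIB n imps)
            (encodeImplication '' dBase (impClosure imps)) (p.eval (sizeIB n imps)) := by
  obtain ⟨p, hp⟩ := RAM.dBaseProg.exists_polynomial_bound
  refine ⟨RAM.dBaseProg, p.comp (2 * Polynomial.X + 2), fun n imps hst => ?_⟩
  have hn : n ≤ sizeIB n imps := Nat.le_add_right _ _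
  have hN : RAM.Ample (2 * sizeIB n imps + 2) imps :=
    ⟨by omega, (length_le_size imps).trans (by omega), impPos_le_size imps⟩
  have := RAM.enumerates_dBaseProg hN (by omega) hst
  simpa [Polynomial.eval_comp, hp] using this
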